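/- Let $f\in S=\mathbb{C}[x_0,x_1,x_2]$ be a homogeneous polynomial of degree $4$. Its rank $\operatorname{rk}(f)$ is the least $r$ such that $f$ is a sum of $r$ fourth powers of linear forms. Let $T=\mathbb{C}[y_0,y_1,y_2]$ act on $S$ by $G\circ f=G(\partial_0,\partial_1,\partial_2)f$, and let $f^\perp_2=\{G\in T_2 : G\circ f=0\}$. For $P=(\xi_0:\xi_1:\xi_2)\in\mathbb{P}^2$ put $\ell_P=\xi_0x_0+\xi_1x_1+\xi_2x_2$ (well defined up to a nonzero scalar). The Waring locus $\mathcal{W}_f\subset\mathbb{P}^2$ is the set of points $P$ for which there are points $P_2,\dots,P_r$, $r=\operatorname{rk}(f)$, with $f\in\langle \ell_P^4,\ell_{P_2}^4,\dots,\ell_{P_r}^4\rangle$; the points of $\mathbb{P}^2\setminus\mathcal{W}_f$ are called forbidden for $f$. For a form $G\in T$ let $Z(G)\subset\mathbb{P}^2$ be its zero locus. "$A$ is dense in $B$" means that $A\subset B$ and that $B$ is contained in the Zariski closure of $A$. Assume that $\operatorname{rk}(f)=5$ and $f^\perp_2=\langle C\rangle$ for some $C\in T_2$. Then: 1. If $C$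 is irreducible, then $\mathcal{W}_f$ is dense in the conic $Z(C)$. 2. If $C$ is reducible, then $C$ is a product of two linear forms, and for every such factorization $C=\ell_1\ell_2$ the lines $Z(\ell_1)$ and $Z(\ell_2)$ meet in exactly one point $Q$, and (a) if $Q$ is not forbidden for $f$, then $\mathcal{W}_f$ is dense in $Z(C)$; (b) if $Q$ is forbidden for $f$, then for exactly one $i\in\{1,2\}$ the set $\mathcal{W}_f\cap Z(\ell_i)$ is dense in $Z(\ell_i)$. -/

import Mathlib

open MvPolynomial
open scoped LinearAlgebra.Projectivization Topology

namespace WaringLoci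

/-- The partial derivative attached to an exponent vector `α`: the composition of the powers
`∂_i ^ (α i)` acting on polynomials in `n + 1` variables. -/
noncomputable def partialPow {n : ℕ} (α : Fin (n + 1) →₀ ℕ) :
    Module.End ℂ (MvPolynomial (Fin (n + 1)) ℂ) :=
  (List.ofFn fun i : Fin (n + 1) =>
    ((pderiv i : Derivation ℂ (MvPolynomial (Fin (n + 1)) ℂ) _).toLinearMap :
      Module.End ℂ (MvPolynomial (Fin (n + 1)) ℂ)) ^ (α i)).prod

/-- The apolar action `G ↦ G ∘ f = G(∂_0, …, ∂_n) f`, as a linear map in `G`: the linear extension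
of the rule that sends the monomial with exponent `α` to the partial derivative `∂^α f`. -/
noncomputable def apolarAction {n : ℕ} (f : MvPolynomial (Fin (n + 1)) ℂ) :
    MvPolynomial (Fin (n + 1)) ℂ →ₗ[ℂ] MvPolynomial (Fin (n + 1)) ℂ :=
  (basisMonomials (Fin (n + 1)) ℂ).constr ℂ fun α => partialPow α f

/-- The degree `k` part `f^⊥_k` of the apolar ideal of `f`: the forms `G` of degree `k`
with `G ∘ f = 0`. -/
noncomputable def apolarPart {n : ℕ} (f : MvPolynomial (Fin (n + 1)) ℂ) (k : ℕ) :
    Submodule ℂ (MvPolynomial (Fin (n + 1)) ℂ) :=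
  homogeneousSubmodule (Fin (n + 1)) ℂ k ⊓ LinearMap.ker (apolarAction f)

/-- The Waring rank of a form `f` of degree `d`: the least `r` such that `f` is a sum of `r`
`d`-th powers of linear forms. -/
noncomputable def waringRank {n : ℕ} (d : ℕ) (f : MvPolynomial (Fin (n + 1)) ℂ) : ℕ :=
  sInf {r : ℕ | ∃ l : Fin r → MvPolynomial (Fin (n + 1)) ℂ,
    (∀ i, (l i).IsHomogeneous 1) ∧ f = ∑ i, l i ^ d}

/-- The linear form `ℓ_P = ξ_0 x_0 + … + ξ_n x_n` of a point `P = (ξ_0 : … : ξ_n)`. It depends on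
the chosen representative of `P` only up to a nonzero scalar. -/
noncomputable def linForm {n : ℕ} (P : ℙ ℂ (Fin (n + 1) → ℂ)) :
    MvPolynomial (Fin (n + 1)) ℂ :=
  ∑ i, C (P.rep i) * X i

/-- The Waring locus of a form `f` of degree `d`: the points `P` such that, with `r` the rank
of `f`, there are `r` points, `P` among them, whose linear forms have `d`-th powers
that span a space containing `f`. -/
def waringLocus {n : ℕ} (d : ℕ) (f : MvPolynomial (Fin (n + 1)) ℂ) :
    Set (ℙ ℂ (Fin (n + 1) → ℂ)) :=
  {P | ∃ p : Fin (waringRank d f) → ℙ ℂ (Fin (n + 1) → ℂ),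
    P ∈ Set.range p ∧ f ∈ Submodule.span ℂ (Set.range fun i => linForm (p i) ^ d)}

/-- The forbidden locus: the complement of the Waring locus. -/
def forbiddenLocus {n : ℕ} (d : ℕ) (f : MvPolynomial (Fin (n + 1)) ℂ) :
    Set (ℙ ℂ (Fin (n + 1) → ℂ)) :=
  (waringLocus d f)ᶜ

/-- The zero locus `Z(g)` in projective space of a form `g`. (For homogeneous `g` the condition
does not depend on the representative; it is used only for such `g`.) -/
def zeroLocus {n : ℕ} (g : MvPolynomial (Fin (n + 1)) ℂ) : Set (ℙ ℂ (Fin (n + 1) → ℂ)) :=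
  {P | eval P.rep g = 0}

/-- The Zariski topology of projective space, generated by the complements of the zero loci
of homogeneous polynomials. -/
@[reducible] def zariski (n : ℕ) : TopologicalSpace (ℙ ℂ (Fin (n + 1) → ℂ)) :=
  TopologicalSpace.generateFrom
    {U | ∃ (d : ℕ) (g : MvPolynomial (Fin (n + 1)) ℂ), g.IsHomogeneous d ∧ U = (zeroLocus g)ᶜ}

/-- `A` is a Zariski dense subset of `B`. -/
def DenseIn {n : ℕ} (A B : Set (ℙ ℂ (Fin (n + 1) → ℂ))) : Prop :=
  A ⊆ B ∧ B ⊆ closure[zariski n] A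

end WaringLoci

namespace WaringLoci

/-! ### Apolarity -/

/-! A quartic `f` is encoded by the functional `Φ = contraction f`, `G ↦ (G ∘ f)(0)`, on quartic
forms. The power `ℓ_P ^ 4` becomes 24 times the evaluation at `P`, so writing `f` as a combination
of five powers means writing `Φ` as a combination of five evaluations (`eq_sum_pow_iff`), and
`f^⊥_2` becomes the radical of the pairing `(G, H) ↦ Φ (G * H)` on quadrics
(`isRadical_contraction`). Five points always lie on a conic; that conic is in the radical, so it is
`Z(C)`, and every decomposition lives on `Z(C)` (`IsRadical.eval_eq_zero`).

The problem is now one-dimensional, and `Polynomial.finite_not_node`, in the spirit of Sylvester,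
solves it. A functional on polynomials of degree at most `2m` with nondegenerate Hankel form has a
pencil of apolar polynomials of degree at most `m + 1` without base points, even at infinity. The
member vanishing at a general `t` has `m + 1` distinct roots, and these are the nodes of a
quadrature formula.

If `C` is irreducible, it is `X₀X₂ - X₁²` in suitable coordinates. Then `Φ` descends to polynomials
in `t` along `(1, t, t²)`, its Hankel form is nondegenerate because the radical is only `⟨C⟩`, and
`m = 4` applies.

If `C` is reducible, its factors are independent and become `X₀` and `X₁`, with `Q = (0:0:1)`. Each
line carries at least two nodes away from `Q` (`not_single_node`), so five nodes split as 2+2 plus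
one at `Q`, or as 2+3. A line that can carry exactly two is called binodal; at least one line is,
and `Q` is a node iff both are. If one line is binodal, removing its two evaluations leaves the case
`m = 2` on the other line, where almost every point is a node (`finite_not_mem_nodeSet_line`). If it
is not binodal, the other line carries exactly two nodes in every decomposition, always zeros of the
same quadric `nodalForm` (`eval_nodalForm_of_not_isBinodal`). So the locus is dense in a line iff
the other line is binodal (`denseIn_line_iff`), and both alternatives follow. -/

/-- The product of the factorials of the entries of an exponent vector. -/
def factorialProd (α : Fin 3 →₀ ℕ) : ℕ := ∏ i : Fin 3, (α i).factorial

lemma factorialProd_ne_zero (α : Fin 3 →₀ ℕ) : (factorialProd α : ℂ) ≠ 0 :=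
  Nat.cast_ne_zero.2 (Finset.prod_ne_zero_iff.2 fun _ _ => Nat.factorial_ne_zero _)

lemma factorialProd_add_single (α : Fin 3 →₀ ℕ) (i : Fin 3) :
    factorialProd (α + Finsupp.single i 1) = (α i + 1) * factorialProd α := by
  have h : ∀ j, (α + Finsupp.single i 1 : Fin 3 →₀ ℕ) j = Function.update α i (α i + 1) j := by
    intro j
    by_cases hj : j = i
    · subst hj; simp
    · simp [hj]
  unfold factorialProd
  rw [← Finset.mul_prod_erase _ _ (Finset.mem_univ i), ← Finset.mul_prod_erase _ _
    (Finset.mem_univ i), h i, Function.update_self, Nat.factorial_succ, mul_assoc]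
  congr 2
  refine Finset.prod_congr rfl fun j hj => ?_
  rw [h j, Function.update_of_ne (Finset.ne_of_mem_erase hj)]

lemma coeff_pderiv_pow (i : Fin 3) (k : ℕ) (f : MvPolynomial (Fin 3) ℂ) (β : Fin 3 →₀ ℕ) :
    (factorialProd β : ℂ) * coeff β ((((pderiv i : Derivation ℂ (MvPolynomial (Fin 3) ℂ)
      _).toLinearMap : Module.End ℂ (MvPolynomial (Fin 3) ℂ)) ^ k) f) =
      factorialProd (β + Finsupp.single i k) * coeff (β + Finsupp.single i k) f := by
  induction k generalizing β with
  | zero => simp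
  | succ k ih =>
    rw [pow_succ', Module.End.mul_apply]
    have h := ih (β + Finsupp.single i 1)
    rw [factorialProd_add_single, add_assoc, ← Finsupp.single_add, add_comm 1 k] at h
    rw [← h]
    change _ * coeff β (pderiv i _) = _
    rw [coeff_pderiv]
    push_cast
    ring

lemma coeff_partialPow (α β : Fin 3 →₀ ℕ) (f : MvPolynomial (Fin 3) ℂ) :
    (factorialProd β : ℂ) * coeff β (partialPow α f) =
      factorialProd (α + β) * coeff (α + β) f := by
  have h : α + β = β + Finsupp.single 0 (α 0) + Finsupp.single 1 (α 1) +
      Finsupp.single 2 (α 2) := by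
    ext i; fin_cases i <;> simp [add_comm]
  simp only [partialPow, List.ofFn_succ, List.ofFn_zero, List.prod_cons, List.prod_nil, mul_one,
    Module.End.mul_apply]
  rw [h]
  rw [coeff_pderiv_pow]
  erw [coeff_pderiv_pow]
  erw [coeff_pderiv_pow]
  rfl

/-- The contraction functional `G ↦ (G ∘ f)(0)`. -/
noncomputable def contraction (f : MvPolynomial (Fin 3) ℂ) : MvPolynomial (Fin 3) ℂ →ₗ[ℂ] ℂ :=
  (basisMonomials (Fin 3) ℂ).constr ℂ fun α => (factorialProd α : ℂ) * coeff α f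

lemma contraction_monomial (f : MvPolynomial (Fin 3) ℂ) (α : Fin 3 →₀ ℕ) :
    contraction f (monomial α 1) = (factorialProd α : ℂ) * coeff α f := by
  have := (basisMonomials (Fin 3) ℂ).constr_basis ℂ
    (fun α => (factorialProd α : ℂ) * coeff α f) α
  simpa [contraction] using this

/-- Contracting by `G` and then by a monomial is contracting by their product; this converts the
differential action into multiplication of forms. -/
lemma coeff_apolarAction (f G : MvPolynomial (Fin 3) ℂ) (β : Fin 3 →₀ ℕ) :
    (factorialProd β : ℂ) * coeff β (apolarAction f G) =
      contraction f (G * monomial β 1) := by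
  have h : (factorialProd β : ℂ) • (lcoeff ℂ β ∘ₗ apolarAction f) =
      contraction f ∘ₗ LinearMap.mulRight ℂ (monomial β 1) := by
    refine (basisMonomials (Fin 3) ℂ).ext fun α => ?_
    have := (basisMonomials (Fin 3) ℂ).constr_basis ℂ (fun α => partialPow α f) α
    simp only [LinearMap.smul_apply, LinearMap.comp_apply, LinearMap.mulRight_apply, lcoeff_apply,
      smul_eq_mul, apolarAction]
    rw [this, coeff_partialPow, coe_basisMonomials, monomial_mul, one_mul, contraction_monomial]
  simpa using LinearMap.congr_fun h G

/-- Linear maps that agree on the monomials of degree `d` agree on the forms of degree `d`. -/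
lemma homogeneous_ext' {V : Type*} [AddCommGroup V] [Module ℂ V] {d : ℕ}
    {φ ψ : MvPolynomial (Fin 3) ℂ →ₗ[ℂ] V}
    (h : ∀ α : Fin 3 →₀ ℕ, α.degree = d → φ (monomial α 1) = ψ (monomial α 1))
    {G : MvPolynomial (Fin 3) ℂ} (hG : G.IsHomogeneous d) : φ G = ψ G := by
  rw [G.as_sum, map_sum, map_sum]
  refine Finset.sum_congr rfl fun α hα => ?_
  have hα' : α.degree = d := by
    by_contra hne
    exact (mem_support_iff.1 hα) (hG.coeff_eq_zero hne)
  have : monomial α (coeff α G) = coeff α G • (monomial α 1 : MvPolynomial (Fin 3) ℂ) := by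
    simp [smul_monomial]
  rw [this, map_smul, map_smul, h α hα']

lemma monomial_eq_X_pow (α : Fin 3 →₀ ℕ) :
    (monomial α 1 : MvPolynomial (Fin 3) ℂ) = X 0 ^ α 0 * X 1 ^ α 1 * X 2 ^ α 2 := by
  rw [monomial_eq, Finsupp.prod_fintype _ _ (by simp), Fin.prod_univ_three]
  simp

lemma degree_fin_three (α : Fin 3 →₀ ℕ) : α.degree = α 0 + α 1 + α 2 := by
  rw [Finsupp.degree_eq_sum, Fin.sum_univ_three]

/-- Linear maps that agree on the monomials of degree `d` agree on the forms of degree `d`. -/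
lemma homogeneous_ext {V : Type*} [AddCommGroup V] [Module ℂ V] {d : ℕ}
    {φ ψ : MvPolynomial (Fin 3) ℂ →ₗ[ℂ] V}
    (h : ∀ a b c : ℕ, a + b + c = d →
      φ (X 0 ^ a * X 1 ^ b * X 2 ^ c) = ψ (X 0 ^ a * X 1 ^ b * X 2 ^ c))
    {G : MvPolynomial (Fin 3) ℂ} (hG : G.IsHomogeneous d) : φ G = ψ G :=
  homogeneous_ext' (fun α hα => by
    rw [monomial_eq_X_pow]; exact h _ _ _ (by rw [← degree_fin_three, hα])) hG

/-- The forms of degree `2` spanned by `C` are the radical of the pairing `(G, H) ↦ Φ (G * H)`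
on forms of degree `2`. -/
def IsRadical (Φ : MvPolynomial (Fin 3) ℂ →ₗ[ℂ] ℂ) (c : MvPolynomial (Fin 3) ℂ) : Prop :=
  ∀ G : MvPolynomial (Fin 3) ℂ, G.IsHomogeneous 2 →
    ((∀ H : MvPolynomial (Fin 3) ℂ, H.IsHomogeneous 2 → Φ (G * H) = 0) ↔ ∃ k : ℂ, G = k • c)

/-- Pairing `G` with monomials reads off the coefficients of `G ∘ f`. Since `f` has degree 4 and `G`
degree 2, only the quadratic monomials can give anything nonzero. -/
lemma isRadical_contraction {f c : MvPolynomial (Fin 3) ℂ} (hf : f.IsHomogeneous 4)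
    (hc : apolarPart f 2 = Submodule.span ℂ {c}) : IsRadical (contraction f) c := by
  intro G hG
  have h1 : (∃ k : ℂ, G = k • c) ↔ G ∈ apolarPart f 2 := by
    rw [hc, Submodule.mem_span_singleton]
    exact ⟨fun ⟨k, hk⟩ => ⟨k, hk.symm⟩, fun ⟨k, hk⟩ => ⟨k, hk.symm⟩⟩
  rw [h1, apolarPart, Submodule.mem_inf, mem_homogeneousSubmodule, LinearMap.mem_ker]
  constructor
  · refine fun h => ⟨hG, ?_⟩
    ext β
    have h2 := coeff_apolarAction f G β
    by_cases hβ : β.degree = 2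
    · rw [h _ (isHomogeneous_monomial _ hβ)] at h2
      exact (mul_eq_zero.1 h2).resolve_left (factorialProd_ne_zero β)
    · have : contraction f (G * monomial β 1) = 0 := by
        have := homogeneous_ext' (φ := contraction f ∘ₗ LinearMap.mulRight ℂ (monomial β 1))
          (ψ := 0) (d := 2) (fun α hα => ?_) hG
        · simpa using this
        · rw [LinearMap.comp_apply, LinearMap.mulRight_apply, monomial_mul, one_mul,
            contraction_monomial, hf.coeff_eq_zero, mul_zero, LinearMap.zero_apply]
          rw [map_add]; omega
      rw [this] at h2
      exact (mul_eq_zero.1 h2).resolve_left (factorialProd_ne_zero β)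
  · rintro ⟨-, h⟩ H hH
    have := homogeneous_ext' (φ := contraction f ∘ₗ LinearMap.mulLeft ℂ G)
      (ψ := 0) (d := 2) (fun β _ => ?_) hH
    · simpa using this
    · rw [LinearMap.comp_apply, LinearMap.mulLeft_apply, ← coeff_apolarAction, h]
      simp

/-! ### Powers of linear forms as evaluations -/

/-- The linear form with given coefficient vector. -/
noncomputable def vecForm (v : Fin 3 → ℂ) : MvPolynomial (Fin 3) ℂ := ∑ i, C (v i) * X i

/-- By the multinomial theorem the coefficient of `vecForm v ^ d` at `α` is `d!/α!` times `v^α`, and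
the contraction multiplies it by `α!`. -/
lemma contraction_vecForm_pow (v : Fin 3 → ℂ) {d : ℕ} {G : MvPolynomial (Fin 3) ℂ}
    (hG : G.IsHomogeneous d) :
    contraction (vecForm v ^ d) G = (d.factorial : ℂ) * eval v G := by
  have h := homogeneous_ext' (φ := contraction (vecForm v ^ d))
    (ψ := (d.factorial : ℂ) • (aeval v : MvPolynomial (Fin 3) ℂ →ₐ[ℂ] ℂ).toLinearMap)
    (fun α hα => ?_) hG
  · simpa [aeval_eq_eval] using h
  · have hv : vecForm v = ∑ i, v i • X i := by simp [vecForm, smul_eq_C_mul]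
    have hsum : (α.sum fun _ m => m) = d := by rw [← hα]; rfl
    have hm : (factorialProd α : ℂ) * α.multinomial = d.factorial := by
      have := Nat.multinomial_spec Finset.univ α
      rw [← Finsupp.multinomial_eq_of_support_subset (Finset.subset_univ _),
        ← Finsupp.degree_eq_sum, hα] at this
      exact_mod_cast this
    rw [contraction_monomial, hv, coeff_linearCombination_X_pow_of_fintype, if_pos hsum,
      ← mul_assoc, hm]
    simp [aeval_eq_eval, eval_monomial]

lemma contraction_injOn {f g : MvPolynomial (Fin 3) ℂ} {d : ℕ} (hf : f.IsHomogeneous d)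
    (hg : g.IsHomogeneous d)
    (h : ∀ G : MvPolynomial (Fin 3) ℂ, G.IsHomogeneous d → contraction f G = contraction g G) :
    f = g := by
  ext α
  by_cases hα : α.degree = d
  · have := h _ (isHomogeneous_monomial 1 hα)
    rw [contraction_monomial, contraction_monomial] at this
    exact mul_left_cancel₀ (factorialProd_ne_zero α) this
  · rw [hf.coeff_eq_zero hα, hg.coeff_eq_zero hα]

lemma contraction_sum_smul {ι : Type*} (s : Finset ι) (a : ι → ℂ)
    (g : ι → MvPolynomial (Fin 3) ℂ) (G : MvPolynomial (Fin 3) ℂ) :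
    contraction (∑ i ∈ s, a i • g i) G = ∑ i ∈ s, a i * contraction (g i) G := by
  have h : contraction (∑ i ∈ s, a i • g i) = ∑ i ∈ s, a i • contraction (g i) := by
    refine (basisMonomials (Fin 3) ℂ).ext fun α => ?_
    simp only [coe_basisMonomials, contraction_monomial, LinearMap.sum_apply, LinearMap.smul_apply,
      coeff_sum, coeff_smul, smul_eq_mul, Finset.mul_sum]
    exact Finset.sum_congr rfl fun i _ => by ring
  simp [h]

lemma isHomogeneous_vecForm (v : Fin 3 → ℂ) : (vecForm v).IsHomogeneous 1 :=
  IsHomogeneous.sum _ _ _ fun _ _ => isHomogeneous_C_mul_X _ _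

/-- A form of degree `4` is a combination of fourth powers of linear forms iff its contraction
functional is the corresponding combination of evaluations. -/
lemma eq_sum_pow_iff {f : MvPolynomial (Fin 3) ℂ} (hf : f.IsHomogeneous 4) {n : ℕ}
    (a : Fin n → ℂ) (v : Fin n → Fin 3 → ℂ) :
    f = ∑ i, a i • vecForm (v i) ^ 4 ↔
      ∀ G : MvPolynomial (Fin 3) ℂ, G.IsHomogeneous 4 →
        contraction f G = ∑ i, (24 * a i) * eval (v i) G := by
  have key : ∀ G : MvPolynomial (Fin 3) ℂ, G.IsHomogeneous 4 →
      contraction (∑ i, a i • vecForm (v i) ^ 4) G = ∑ i, (24 * a i) * eval (v i) G := by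
    intro G hG
    rw [contraction_sum_smul]
    refine Finset.sum_congr rfl fun i _ => ?_
    rw [contraction_vecForm_pow _ hG]
    norm_num [Nat.factorial]
    ring
  constructor
  · intro h G hG
    rw [h, key G hG]
  · intro h
    refine contraction_injOn hf (IsHomogeneous.sum _ _ _ fun i _ => ?_) fun G hG => ?_
    · rw [smul_eq_C_mul]
      simpa using ((isHomogeneous_vecForm (v i)).pow 4).C_mul (a i)
    · rw [h G hG, key G hG]

end WaringLoci

namespace Polynomial

/-! ### Sums of powers of binary forms, in terms of moment functionals -/

variable {L : ℂ[X] →ₗ[ℂ] ℂ} {m : ℕ}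

/-- The pencil of polynomials of degree at most `m + 1` annihilated by a moment functional. -/
lemma exists_apolar_pencil (L : ℂ[X] →ₗ[ℂ] ℂ) (m : ℕ) :
    ∃ u v : ℂ[X], LinearIndependent ℂ ![u, v] ∧ (u.natDegree ≤ m + 1 ∧ v.natDegree ≤ m + 1) ∧
      (∀ q : ℂ[X], q.degree < m → L (u * q) = 0) ∧
      ∀ q : ℂ[X], q.degree < m → L (v * q) = 0 := by
  have hfr : ∀ n : ℕ, Module.finrank ℂ (degreeLT ℂ n) = n := fun n => by
    rw [(degreeLTEquiv ℂ n).finrank_eq, Module.finrank_fin_fun]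
  have hfin : ∀ n : ℕ, FiniteDimensional ℂ (degreeLT ℂ n) := fun n =>
    (degreeLTEquiv ℂ n).symm.finiteDimensional
  have := hfin m
  have := hfin (m + 2)
  let φ : degreeLT ℂ (m + 2) →ₗ[ℂ] Module.Dual ℂ (degreeLT ℂ m) :=
    ((LinearMap.mul ℂ ℂ[X]).compr₂ L).domRestrict₁₂ _ _
  have hφ : ∀ p ∈ LinearMap.ker φ, ∀ q : ℂ[X], q.degree < m → L ((p : ℂ[X]) * q) = 0 :=
    fun p hp q hq => LinearMap.congr_fun (LinearMap.mem_ker.1 hp) ⟨q, mem_degreeLT.2 hq⟩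
  -- The source has dimension `m + 2` and the target `m`, so the kernel has dimension at least 2.
  have hker : 1 < Module.finrank ℂ (LinearMap.ker φ) := by
    have h1 := LinearMap.finrank_range_add_finrank_ker φ
    have h2 := Submodule.finrank_le (LinearMap.range φ)
    rw [Subspace.dual_finrank_eq, hfr] at h2
    rw [hfr] at h1
    omega
  have hdeg : ∀ p : degreeLT ℂ (m + 2), (p : ℂ[X]).natDegree ≤ m + 1 := fun p =>
    natDegree_le_iff_coeff_eq_zero.2 fun N hN =>
      (degree_lt_iff_coeff_zero _ _).1 (mem_degreeLT.1 p.2) N hN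
  have := Module.nontrivial_of_finrank_pos (zero_lt_one.trans hker)
  obtain ⟨u, hu0⟩ := exists_ne (0 : LinearMap.ker φ)
  obtain ⟨v, huv⟩ := exists_linearIndependent_pair_of_one_lt_finrank (R := ℂ)
    (M := LinearMap.ker φ) hker hu0
  refine ⟨u, v, ?_, ⟨hdeg _, hdeg _⟩, hφ u u.2, hφ v v.2⟩
  exact LinearIndependent.pair_iff.2 fun a b hab =>
    (LinearIndependent.pair_iff (R := ℂ) (M := LinearMap.ker φ)).1 huv a b
      (Subtype.ext (Subtype.ext hab))

/-- If the Hankel form of `L` is nondegenerate on polynomials of degree at most `m`, two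
linearly independent members of degree at most `m` cannot both annihilate a hyperplane. -/
lemma not_linearIndependent_of_apolar
    (hL : ∀ p : ℂ[X], p.natDegree ≤ m → (∀ q : ℂ[X], q.natDegree ≤ m → L (p * q) = 0) → p = 0)
    {p q h : ℂ[X]} (hp : p.natDegree ≤ m) (hq : q.natDegree ≤ m)
    (hh : ∀ r : ℂ[X], r.natDegree ≤ m → ∃ (k : ℂ) (s : ℂ[X]), r = k • h + s ∧
      L (p * s) = 0 ∧ L (q * s) = 0) :
    ¬ LinearIndependent ℂ ![p, q] := by
  intro hli
  rw [LinearIndependent.pair_iff] at hli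
  have key : ∀ a b : ℂ, a * L (p * h) + b * L (q * h) = 0 → a = 0 ∧ b = 0 := by
    intro a b hab
    refine hli a b (hL _ ?_ fun r hr => ?_)
    · exact (natDegree_add_le _ _).trans
        (max_le ((natDegree_smul_le _ _).trans hp) ((natDegree_smul_le _ _).trans hq))
    · obtain ⟨k, s, rfl, h1, h2⟩ := hh r hr
      have : (a • p + b • q) * (k • h + s) =
          (k * a) • (p * h) + (k * b) • (q * h) + (a • (p * s) + b • (q * s)) := by
        simp only [smul_eq_C_mul, C_mul]; ring
      rw [this]
      simp only [map_add, map_smul, h1, h2, smul_eq_mul]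
      linear_combination k * hab
  -- This combination of `p` and `q` also kills `h`, so it pairs to zero with everything;
  -- nondegeneracy gives `L (p * h) = 0`, which puts `p` itself in the kernel.
  have h1 := key (L (q * h)) (-L (p * h)) (by ring)
  have h2 := key 1 0 (by rw [neg_eq_zero.1 h1.2]; ring)
  exact one_ne_zero h2.1

/-- Gauss quadrature: reducing `p` modulo `g` does not change `L p`, and the remainder is
interpolated at the `m + 1` distinct roots of `g`. The weights are the values of `L` on the Lagrange
basis. -/
lemma exists_nodes_of_apolar {g : ℂ[X]} (hg : g.natDegree = m + 1) (hs : g.Separable)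
    (hL : ∀ q : ℂ[X], q.degree < m → L (g * q) = 0) {t : ℂ} (ht : g.eval t = 0) :
    ∃ (x : Fin (m + 1) → ℂ) (a : Fin (m + 1) → ℂ), x 0 = t ∧
      ∀ p : ℂ[X], p.natDegree ≤ 2 * m → L p = ∑ i, a i * p.eval (x i) := by
  classical
  have hg0 : g ≠ 0 := by rintro rfl; simp at hg
  have hcard : g.roots.toFinset.card = m + 1 := by
    rw [Multiset.toFinset_card_of_nodup (nodup_roots hs), ← hg]
    exact (splits_iff_card_roots.1 (IsAlgClosed.splits g))
  have htm : t ∈ g.roots.toFinset := by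
    rw [Multiset.mem_toFinset, mem_roots hg0]; exact ht
  obtain ⟨e⟩ : Nonempty (Fin (m + 1) ≃ g.roots.toFinset) :=
    ⟨(Finset.equivFinOfCardEq hcard).symm⟩
  let e' := (Equiv.swap 0 (e.symm ⟨t, htm⟩)).trans e
  let x : Fin (m + 1) → ℂ := fun i => (e' i : ℂ)
  have hx0 : x 0 = t := by simp [x, e']
  have hxinj : Set.InjOn x (Finset.univ : Finset (Fin (m + 1))) := fun i _ j _ hij =>
    e'.injective (Subtype.ext hij)
  have hxroot : ∀ i, g.eval (x i) = 0 := fun i => by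
    have := (e' i).2
    rw [Multiset.mem_toFinset, mem_roots hg0] at this
    exact this
  refine ⟨x, fun i => L (Lagrange.basis Finset.univ x i), hx0, fun p hp => ?_⟩
  have hdiv := EuclideanDomain.div_add_mod p g
  set q := p / g with hq
  set r := p % g with hr
  -- The quotient has degree at most `2m - (m + 1)`, which is within the range where `g` is apolar.
  have hqdeg : q.degree < m := by
    by_cases hq0 : q = 0
    · rw [hq0, degree_zero]; exact WithBot.bot_lt_coe _
    rw [degree_eq_natDegree hq0]
    have h1 : p.natDegree = g.natDegree + q.natDegree := by
      have hqg : ¬ p.degree < g.degree := fun h => hq0 ((Polynomial.div_eq_zero_iff hg0).2 h)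
      rw [← natDegree_mul hg0 hq0]
      have h2 := degree_add_div hg0 (not_lt.1 hqg)
      rw [← hq, ← degree_mul] at h2
      exact (natDegree_eq_of_degree_eq h2).symm
    exact_mod_cast (by omega : q.natDegree < m)
  have hrdeg : r.degree < (Finset.univ : Finset (Fin (m + 1))).card := by
    rw [Finset.card_univ, Fintype.card_fin, ← hg, ← degree_eq_natDegree hg0]
    exact degree_mod_lt p hg0
  have hreval : ∀ i, r.eval (x i) = p.eval (x i) := fun i => by
    rw [← hdiv, eval_add, eval_mul, hxroot i]; ring
  rw [← hdiv, map_add, hL q hqdeg, zero_add, hdiv,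
    Lagrange.eq_interpolate hxinj hrdeg, Lagrange.interpolate_apply, map_sum]
  refine Finset.sum_congr rfl fun i _ => ?_
  rw [← smul_eq_C_mul, map_smul, smul_eq_mul, hreval, mul_comm]

/-- If the Hankel form of a moment functional `L` is nondegenerate on polynomials of degree at
most `m`, then `L` is a combination of `m + 1` evaluations, and all but finitely many points
occur as nodes of such a combination. -/
theorem finite_not_node
    (hL : ∀ p : ℂ[X], p.natDegree ≤ m → (∀ q : ℂ[X], q.natDegree ≤ m → L (p * q) = 0) → p = 0) :
    {t : ℂ | ¬ ∃ (x : Fin (m + 1) → ℂ) (a : Fin (m + 1) → ℂ), x 0 = t ∧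
      ∀ p : ℂ[X], p.natDegree ≤ 2 * m → L p = ∑ i, a i * p.eval (x i)}.Finite := by
  obtain ⟨u, v, hli, ⟨hu, hv⟩, hLu, hLv⟩ := exists_apolar_pencil L m
  have hli' := LinearIndependent.pair_iff.1 hli
  -- After division by a common factor `X - x`, both cofactors annihilate the multiples of `X - x`
  -- of degree at most `m`, a hyperplane.
  have hroot : ∀ x : ℂ, ¬ (u.eval x = 0 ∧ v.eval x = 0) := by
    rintro x ⟨hux, hvx⟩
    obtain ⟨p, rfl⟩ := dvd_iff_isRoot.2 hux
    obtain ⟨q, rfl⟩ := dvd_iff_isRoot.2 hvx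
    have hdeg : ∀ p : ℂ[X], ((X - C x) * p).natDegree ≤ m + 1 → p.natDegree ≤ m := by
      intro p hp
      by_cases hp0 : p = 0
      · simp [hp0]
      · rw [natDegree_mul (X_sub_C_ne_zero x) hp0, natDegree_X_sub_C] at hp
        omega
    refine not_linearIndependent_of_apolar hL (h := 1) (hdeg p hu) (hdeg q hv) (fun r hr => ?_) ?_
    · obtain ⟨s, hs⟩ := X_sub_C_dvd_sub_C_eval (p := r) (a := x)
      have hsd : s.degree < m := by
        by_cases hs0 : s = 0
        · rw [hs0, degree_zero]; exact WithBot.bot_lt_coe _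
        rw [degree_eq_natDegree hs0]
        have h1 : ((X - C x) * s).natDegree ≤ m := by
          rw [← hs]; exact (natDegree_sub_C (p := r) (a := r.eval x)).le.trans hr
        rw [natDegree_mul (X_sub_C_ne_zero x) hs0, natDegree_X_sub_C] at h1
        exact_mod_cast (by omega : s.natDegree < m)
      refine ⟨r.eval x, (X - C x) * s, ?_, ?_, ?_⟩
      · rw [← hs, smul_eq_C_mul]; ring
      · rw [← hLu s hsd]; congr 1; ring
      · rw [← hLv s hsd]; congr 1; ring
    · rw [LinearIndependent.pair_iff]
      intro a b hab
      refine hli' a b ?_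
      have : a • ((X - C x) * p) + b • ((X - C x) * q) = (X - C x) * (a • p + b • q) := by
        simp only [smul_eq_C_mul]; ring
      rw [this, hab, mul_zero]
  -- This excludes a common root at infinity; the hyperplane is now the polynomials of degree less
  -- than `m`.
  have hlead : ¬ (u.coeff (m + 1) = 0 ∧ v.coeff (m + 1) = 0) := by
    rintro ⟨h1, h2⟩
    have hdeg : ∀ p : ℂ[X], p.natDegree ≤ m + 1 → p.coeff (m + 1) = 0 → p.natDegree ≤ m := by
      intro p hp h0
      by_contra hlt
      have : p.natDegree = m + 1 := by omega
      rw [← this, coeff_natDegree, leadingCoeff_eq_zero] at h0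
      simp [h0] at this
    refine not_linearIndependent_of_apolar hL (h := X ^ m) (hdeg u hu h1) (hdeg v hv h2)
      (fun r hr => ?_) hli
    have hsd : (r - C (r.coeff m) * X ^ m).degree < (m : WithBot ℕ) := by
      rw [degree_lt_iff_coeff_zero]
      intro k hk
      rcases hk.eq_or_lt with rfl | hk
      · simp
      · have : r.coeff k = 0 := coeff_eq_zero_of_natDegree_lt (by omega)
        simp [coeff_X_pow, this, hk.ne']
    exact ⟨r.coeff m, r - C (r.coeff m) * X ^ m, by rw [smul_eq_C_mul]; ring, hLu _ hsd,
      hLv _ hsd⟩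
  have hcop : IsCoprime u v := by
    by_contra hnc
    obtain ⟨x, hx1, hx2⟩ : ∃ x, u.eval x = 0 ∧ v.eval x = 0 := by
      rw [isCoprime_iff_aeval_ne_zero_of_isAlgClosed ℂ ℂ] at hnc
      push Not at hnc
      simpa [coe_aeval_eq_eval] using hnc
    exact hroot x ⟨hx1, hx2⟩
  have hw : wronskian u v ≠ 0 := by
    rw [Ne, hcop.wronskian_eq_zero_iff]
    rintro ⟨h1, h2⟩
    refine hlead ⟨?_, ?_⟩
    · exact coeff_eq_zero_of_natDegree_lt (by
        rw [derivative_eq_zero.1 h1]; omega)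
    · exact coeff_eq_zero_of_natDegree_lt (by
        rw [derivative_eq_zero.1 h2]; omega)
  have hcomb : ∀ a b : ℂ, ¬ (a = 0 ∧ b = 0) → C a * v - C b * u ≠ 0 := by
    intro a b hab h
    have := hli' (-b) a (by simp only [smul_eq_C_mul, C_neg]; rw [← h]; ring)
    exact hab ⟨this.2, neg_eq_zero.1 this.1⟩
  -- The `t` for which the pencil member vanishing at `t` drops in degree.
  have hfin1 : {t : ℂ | (C (u.coeff (m + 1)) * v - C (v.coeff (m + 1)) * u).eval t = 0}.Finite :=
    finite_setOfPred_isRoot (hcomb _ _ hlead)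
  -- The `t` for which that member may have a multiple root: such a root `x` is a zero of the
  -- Wronskian, and `t` is then a root of the member vanishing at `x`.
  have hfin2 : (⋃ x ∈ (wronskian u v).rootSet ℂ,
      {t : ℂ | (C (u.eval x) * v - C (v.eval x) * u).eval t = 0}).Finite := by
    refine Set.Finite.biUnion (rootSet_finite _ _) fun x _ => ?_
    exact finite_setOfPred_isRoot (hcomb _ _ (hroot x))
  refine (hfin1.union hfin2).subset fun t ht => ?_
  by_contra hbad
  rw [Set.mem_union, not_or] at hbad
  obtain ⟨hb1, hb2⟩ := hbad
  refine ht ?_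
  set g : ℂ[X] := C (v.eval t) * u - C (u.eval t) * v with hgdef
  have hgdeg : g.natDegree = m + 1 := by
    refine natDegree_eq_of_le_of_coeff_ne_zero ?_ ?_
    · exact (natDegree_sub_le _ _).trans (max_le ((natDegree_C_mul_le _ _).trans hu)
        ((natDegree_C_mul_le _ _).trans hv))
    · intro h
      apply hb1
      simp only [hgdef, coeff_sub, coeff_C_mul] at h
      simp only [Set.mem_ofPred_eq, eval_sub, eval_mul, eval_C]
      linear_combination h
  refine exists_nodes_of_apolar hgdeg ?_ (fun q hq => ?_) (t := t) ?_
  · by_contra hns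
    obtain ⟨x, hx1, hx2⟩ : ∃ x, g.eval x = 0 ∧ (derivative g).eval x = 0 := by
      rw [Polynomial.Separable, isCoprime_iff_aeval_ne_zero_of_isAlgClosed ℂ ℂ] at hns
      push Not at hns
      simpa [coe_aeval_eq_eval] using hns
    apply hb2
    simp only [hgdef, derivative_sub, derivative_C_mul, eval_sub, eval_mul, eval_C] at hx1 hx2
    rw [Set.mem_iUnion₂]
    refine ⟨x, ?_, ?_⟩
    · rw [mem_rootSet]
      refine ⟨hw, ?_⟩
      -- The nonzero vector `(v(t), -u(t))` annihilates `(u, v)` and `(u', v')` at `x`, so their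
      -- determinant, the Wronskian, vanishes there.
      have h1 : u.eval t * (wronskian u v).eval x = 0 := by
        simp only [wronskian, eval_sub, eval_mul]
        linear_combination (derivative u).eval x * hx1 - u.eval x * hx2
      have h2 : v.eval t * (wronskian u v).eval x = 0 := by
        simp only [wronskian, eval_sub, eval_mul]
        linear_combination (derivative v).eval x * hx1 - v.eval x * hx2
      rw [coe_aeval_eq_eval]
      by_contra hne
      exact hroot t ⟨(mul_eq_zero.1 h1).resolve_right hne, (mul_eq_zero.1 h2).resolve_right hne⟩
    · simp only [Set.mem_ofPred_eq, eval_sub, eval_mul, eval_C]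
      linear_combination hx1
  · have : g * q = v.eval t • (u * q) - u.eval t • (v * q) := by
      simp only [hgdef, smul_eq_C_mul]; ring
    rw [this, map_sub, map_smul, map_smul, hLu q hq, hLv q hq]
    simp
  · simp only [hgdef, eval_sub, eval_mul, eval_C]; ring

end Polynomial

namespace WaringLoci

/-! ### Linear changes of coordinates -/

/-- The substitution homomorphism `G ↦ G ∘ M` attached to a linear map `M`. -/
noncomputable def linSubst (M : (Fin 3 → ℂ) →ₗ[ℂ] (Fin 3 → ℂ)) :
    MvPolynomial (Fin 3) ℂ →ₐ[ℂ] MvPolynomial (Fin 3) ℂ :=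
  aeval fun i => vecForm fun j => M (Pi.single j 1) i

lemma eval_vecForm (a v : Fin 3 → ℂ) : eval v (vecForm a) = ∑ i, a i * v i := by
  simp [vecForm]

lemma eval_linSubst (M : (Fin 3 → ℂ) →ₗ[ℂ] (Fin 3 → ℂ)) (v : Fin 3 → ℂ)
    (G : MvPolynomial (Fin 3) ℂ) : eval v (linSubst M G) = eval (M v) G := by
  have h : (fun i => eval v (vecForm fun j => M (Pi.single j 1) i)) = M v := by
    ext i
    rw [eval_vecForm, LinearMap.pi_apply_eq_sum_univ M v, Finset.sum_apply]
    refine Finset.sum_congr rfl fun j _ => ?_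
    rw [Pi.smul_apply, smul_eq_mul, mul_comm (v j)]
    exact congrArg (fun w => M w i * v j) (funext fun k => by simp [Pi.single_apply, eq_comm])
  induction G using MvPolynomial.induction_on with
  | C a => simp [linSubst, algebraMap_eq]
  | add p q hp hq => simp [hp, hq]
  | mul_X p i hp =>
    rw [map_mul, map_mul, map_mul, hp, eval_X, ← h, linSubst, aeval_X]

lemma isHomogeneous_linSubst (M : (Fin 3 → ℂ) →ₗ[ℂ] (Fin 3 → ℂ)) {d : ℕ}
    {G : MvPolynomial (Fin 3) ℂ} (hG : G.IsHomogeneous d) : (linSubst M G).IsHomogeneous d := by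
  simpa only [one_mul, linSubst] using hG.aeval _ (n := 1) fun i => isHomogeneous_vecForm fun j => M (Pi.single j 1) i

lemma linSubst_linSubst_symm (e : (Fin 3 → ℂ) ≃ₗ[ℂ] (Fin 3 → ℂ)) (G : MvPolynomial (Fin 3) ℂ) :
    linSubst (e : (Fin 3 → ℂ) →ₗ[ℂ] (Fin 3 → ℂ))
      (linSubst (e.symm : (Fin 3 → ℂ) →ₗ[ℂ] (Fin 3 → ℂ)) G) = G :=
  MvPolynomial.funext fun v => by simp [eval_linSubst]

lemma linSubst_symm_linSubst (e : (Fin 3 → ℂ) ≃ₗ[ℂ] (Fin 3 → ℂ)) (G : MvPolynomial (Fin 3) ℂ) :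
    linSubst (e.symm : (Fin 3 → ℂ) →ₗ[ℂ] (Fin 3 → ℂ))
      (linSubst (e : (Fin 3 → ℂ) →ₗ[ℂ] (Fin 3 → ℂ)) G) = G :=
  linSubst_linSubst_symm e.symm G

lemma exists_eq_vecForm {l : MvPolynomial (Fin 3) ℂ} (hl : l.IsHomogeneous 1) :
    ∃ a, l = vecForm a := by
  have := (mem_homogeneousSubmodule _ _).2 hl
  rw [homogeneousSubmodule_one_eq_span_X, Submodule.mem_span_range_iff_exists_fun] at this
  obtain ⟨v, hv⟩ := this
  exact ⟨v, by simp [vecForm, ← hv, smul_eq_C_mul]⟩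

/-! ### Decompositions into five evaluations and their nodes -/

/-- The functional `Φ` written in the coordinates given by `e`. -/
noncomputable def pull (e : (Fin 3 → ℂ) ≃ₗ[ℂ] (Fin 3 → ℂ)) (Φ : MvPolynomial (Fin 3) ℂ →ₗ[ℂ] ℂ) :
    MvPolynomial (Fin 3) ℂ →ₗ[ℂ] ℂ :=
  Φ ∘ₗ (linSubst (e.symm : (Fin 3 → ℂ) →ₗ[ℂ] (Fin 3 → ℂ))).toLinearMap

lemma pull_apply (e : (Fin 3 → ℂ) ≃ₗ[ℂ] (Fin 3 → ℂ)) (Φ : MvPolynomial (Fin 3) ℂ →ₗ[ℂ] ℂ)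
    (G : MvPolynomial (Fin 3) ℂ) :
    pull e Φ G = Φ (linSubst (e.symm : (Fin 3 → ℂ) →ₗ[ℂ] (Fin 3 → ℂ)) G) := rfl

/-- On forms of degree `4`, `Φ` is the combination with coefficients `a` of the evaluations
at the vectors `v`. -/
def IsDecomp (Φ : MvPolynomial (Fin 3) ℂ →ₗ[ℂ] ℂ) (a : Fin 5 → ℂ) (v : Fin 5 → Fin 3 → ℂ) :
    Prop :=
  ∀ G : MvPolynomial (Fin 3) ℂ, G.IsHomogeneous 4 → Φ G = ∑ i, a i * eval (v i) G

/-- The nonzero vectors that occur in a decomposition of `Φ` into five evaluations. -/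
def nodeSet (Φ : MvPolynomial (Fin 3) ℂ →ₗ[ℂ] ℂ) : Set (Fin 3 → ℂ) :=
  {u | ∃ (a : Fin 5 → ℂ) (v : Fin 5 → Fin 3 → ℂ), IsDecomp Φ a v ∧ (∀ i, v i ≠ 0) ∧ ∃ i, v i = u}

lemma isDecomp_pull_iff {e : (Fin 3 → ℂ) ≃ₗ[ℂ] (Fin 3 → ℂ)} {Φ : MvPolynomial (Fin 3) ℂ →ₗ[ℂ] ℂ}
    {a : Fin 5 → ℂ} {v : Fin 5 → Fin 3 → ℂ} :
    IsDecomp (pull e Φ) a v ↔ IsDecomp Φ a fun i => e (v i) := by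
  constructor
  · intro h G hG
    have := h _ (isHomogeneous_linSubst (e : (Fin 3 → ℂ) →ₗ[ℂ] (Fin 3 → ℂ)) hG)
    rw [pull_apply, linSubst_symm_linSubst] at this
    simpa [eval_linSubst] using this
  · intro h G hG
    have := h _ (isHomogeneous_linSubst (e.symm : (Fin 3 → ℂ) →ₗ[ℂ] (Fin 3 → ℂ)) hG)
    rw [← pull_apply] at this
    simpa [eval_linSubst] using this

lemma mem_nodeSet_pull_iff {e : (Fin 3 → ℂ) ≃ₗ[ℂ] (Fin 3 → ℂ)}
    {Φ : MvPolynomial (Fin 3) ℂ →ₗ[ℂ] ℂ} {u : Fin 3 → ℂ} :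
    u ∈ nodeSet (pull e Φ) ↔ e u ∈ nodeSet Φ := by
  constructor
  · rintro ⟨a, v, h, h0, i, hi⟩
    exact ⟨a, _, isDecomp_pull_iff.1 h, fun j => by simpa using h0 j, i, by rw [hi]⟩
  · rintro ⟨a, v, h, h0, i, hi⟩
    refine ⟨a, fun j => e.symm (v j), isDecomp_pull_iff.2 (by simpa using h),
      fun j => by simpa using h0 j, i, by simp [hi]⟩

lemma isRadical_pull {e : (Fin 3 → ℂ) ≃ₗ[ℂ] (Fin 3 → ℂ)} {Φ : MvPolynomial (Fin 3) ℂ →ₗ[ℂ] ℂ}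
    {c : MvPolynomial (Fin 3) ℂ} (h : IsRadical Φ c) :
    IsRadical (pull e Φ) (linSubst (e : (Fin 3 → ℂ) →ₗ[ℂ] (Fin 3 → ℂ)) c) := by
  intro G hG
  have h1 := h _ (isHomogeneous_linSubst (e.symm : (Fin 3 → ℂ) →ₗ[ℂ] (Fin 3 → ℂ)) hG)
  constructor
  · intro h2
    obtain ⟨k, hk⟩ := h1.1 fun H hH => by
      have := h2 _ (isHomogeneous_linSubst (e : (Fin 3 → ℂ) →ₗ[ℂ] (Fin 3 → ℂ)) hH)
      rwa [pull_apply, map_mul, linSubst_symm_linSubst] at this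
    refine ⟨k, ?_⟩
    rw [← map_smul, ← hk, linSubst_linSubst_symm]
  · rintro ⟨k, rfl⟩ H hH
    rw [pull_apply, map_mul]
    refine h1.2 ⟨k, ?_⟩ _ (isHomogeneous_linSubst _ hH)
    rw [map_smul, linSubst_symm_linSubst]

lemma IsHomogeneous.eval_smul {d : ℕ} {G : MvPolynomial (Fin 3) ℂ} (hG : G.IsHomogeneous d)
    (k : ℂ) (v : Fin 3 → ℂ) : eval (k • v) G = k ^ d * eval v G := by
  have := homogeneous_ext (φ := (aeval (k • v) : MvPolynomial (Fin 3) ℂ →ₐ[ℂ] ℂ).toLinearMap)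
    (ψ := (k ^ d) • (aeval v : MvPolynomial (Fin 3) ℂ →ₐ[ℂ] ℂ).toLinearMap) ?_ hG
  · simpa [aeval_eq_eval] using this
  · rintro a b c rfl
    simp
    ring

lemma smul_mem_nodeSet {Φ : MvPolynomial (Fin 3) ℂ →ₗ[ℂ] ℂ} {u : Fin 3 → ℂ} (hu : u ∈ nodeSet Φ)
    {k : ℂ} (hk : k ≠ 0) : k • u ∈ nodeSet Φ := by
  obtain ⟨a, v, h, h0, i, rfl⟩ := hu
  -- Scaling the nodes by `k` multiplies quartic values by `k ^ 4`; the weights compensate.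
  refine ⟨fun j => a j * (k⁻¹) ^ 4, fun j => k • v j, fun G hG => ?_, fun j => ?_, i, rfl⟩
  · rw [h G hG]
    refine Finset.sum_congr rfl fun j _ => ?_
    rw [IsHomogeneous.eval_smul hG]
    field_simp
  · exact smul_ne_zero hk (h0 j)

lemma mem_waringLocus_iff {f : MvPolynomial (Fin 3) ℂ} (hf : f.IsHomogeneous 4)
    (hrank : waringRank 4 f = 5) {P : ℙ ℂ (Fin 3 → ℂ)} :
    P ∈ waringLocus 4 f ↔ P.rep ∈ nodeSet (contraction f) := by
  unfold waringLocus
  rw [Set.mem_ofPred_eq, hrank]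
  constructor
  · rintro ⟨p, ⟨i, rfl⟩, hp⟩
    obtain ⟨a, ha⟩ := (Submodule.mem_span_range_iff_exists_fun ℂ).1 hp
    exact ⟨_, fun i => (p i).rep, (eq_sum_pow_iff hf a _).1 ha.symm,
      fun i => (p i).rep_nonzero, i, rfl⟩
  · rintro ⟨a, v, h, h0, i, hi⟩
    refine ⟨fun j => Projectivization.mk ℂ (v j) (h0 j), ⟨i, ?_⟩, ?_⟩
    · simp only [hi, Projectivization.mk_rep]
    · have hk : ∀ j, ∃ k : ℂ, v j = k • (Projectivization.mk ℂ (v j) (h0 j)).rep := by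
        intro j
        obtain ⟨k, hk⟩ := Projectivization.exists_smul_eq_mk_rep ℂ (v j) (h0 j)
        refine ⟨(k⁻¹ : ℂˣ), ?_⟩
        rw [← hk, ← Units.smul_def, inv_smul_smul]
      choose k hk using hk
      refine (Submodule.mem_span_range_iff_exists_fun ℂ).2
        ⟨fun j => 24⁻¹ * (a j * k j ^ 4), ((eq_sum_pow_iff hf _ _).2 fun G hG => ?_).symm⟩
      rw [h G hG]
      refine Finset.sum_congr rfl fun j _ => ?_
      rw [hk j, IsHomogeneous.eval_smul hG]
      ring

lemma mk_mem_waringLocus_iff {f : MvPolynomial (Fin 3) ℂ} (hf : f.IsHomogeneous 4)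
    (hrank : waringRank 4 f = 5) {v : Fin 3 → ℂ} (hv : v ≠ 0) :
    Projectivization.mk ℂ v hv ∈ waringLocus 4 f ↔ v ∈ nodeSet (contraction f) := by
  rw [mem_waringLocus_iff hf hrank]
  obtain ⟨k, hk⟩ := Projectivization.exists_smul_eq_mk_rep ℂ v hv
  rw [← hk]
  constructor
  · intro h
    have := smul_mem_nodeSet h (k⁻¹).ne_zero
    rwa [← Units.smul_def, inv_smul_smul] at this
  · exact fun h => smul_mem_nodeSet h k.ne_zero

lemma mk_mem_zeroLocus_iff {d : ℕ} {g : MvPolynomial (Fin 3) ℂ} (hg : g.IsHomogeneous d)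
    {v : Fin 3 → ℂ} (hv : v ≠ 0) : Projectivization.mk ℂ v hv ∈ zeroLocus g ↔ eval v g = 0 := by
  obtain ⟨k, hk⟩ := Projectivization.exists_smul_eq_mk_rep ℂ v hv
  rw [zeroLocus, Set.mem_ofPred_eq, ← hk, Units.smul_def, IsHomogeneous.eval_smul hg]
  simp

lemma exists_isDecomp {f : MvPolynomial (Fin 3) ℂ} (hf : f.IsHomogeneous 4)
    (hrank : waringRank 4 f = 5) : ∃ a v, IsDecomp (contraction f) a v := by
  -- The infimum of the empty set of naturals is 0, so rank 5 guarantees that some decomposition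
  -- exists.
  have hne : {r : ℕ | ∃ l : Fin r → MvPolynomial (Fin 3) ℂ,
      (∀ i, (l i).IsHomogeneous 1) ∧ f = ∑ i, l i ^ 4}.Nonempty := by
    by_contra h
    rw [Set.not_nonempty_iff_eq_empty] at h
    unfold waringRank at hrank
    rw [h, Nat.sInf_empty] at hrank
    omega
  obtain ⟨l, hl, hfl⟩ : 5 ∈ {r : ℕ | ∃ l : Fin r → MvPolynomial (Fin 3) ℂ,
      (∀ i, (l i).IsHomogeneous 1) ∧ f = ∑ i, l i ^ 4} := by
    have := Nat.sInf_mem hne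
    unfold waringRank at hrank
    rwa [hrank] at this
  have hv : ∀ i, ∃ v, l i = vecForm v := fun i =>
    exists_eq_vecForm (hl i)
  choose v hv using hv
  refine ⟨_, v, (eq_sum_pow_iff hf (fun _ => 1) v).1 ?_⟩
  simpa [hv] using hfl

/-! ### Density -/

/-- If the forms vanishing at infinitely many points of the curve `γ` vanish on `B`, and `A`
contains all but finitely many points of `γ`, then `B` lies in the Zariski closure of `A`. -/
lemma subset_closure_of_curve {A B : Set (ℙ ℂ (Fin 3 → ℂ))} (γ : ℂ → ℙ ℂ (Fin 3 → ℂ))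
    (hA : {t | γ t ∉ A}.Finite)
    (hB : ∀ P ∈ B, ∀ (d : ℕ) (g : MvPolynomial (Fin 3) ℂ), g.IsHomogeneous d →
      {t | γ t ∈ zeroLocus g}.Infinite → P ∈ zeroLocus g) :
    B ⊆ closure[zariski 2] A := by
  intro P hP
  let := zariski 2
  -- Every open neighbourhood of `P` contains all but finitely many points of the curve; by
  -- induction on how opens are generated, it suffices to treat the basic ones.
  have key : ∀ U : Set (ℙ ℂ (Fin 3 → ℂ)), TopologicalSpace.GenerateOpen
      {U | ∃ (d : ℕ) (g : MvPolynomial (Fin 3) ℂ), g.IsHomogeneous d ∧ U = (zeroLocus g)ᶜ} U →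
      P ∈ U → {t | γ t ∉ U}.Finite := by
    intro U hU
    induction hU with
    | basic U hU =>
      obtain ⟨d, g, hg, rfl⟩ := hU
      intro hPU
      by_contra hinf
      exact hPU (hB P hP d g hg (by simpa using hinf))
    | univ => simp
    | inter U V _ _ hU hV =>
      intro hPU
      refine ((hU hPU.1).union (hV hPU.2)).subset fun t ht => ?_
      by_contra h
      simp only [Set.mem_union, Set.mem_ofPred_eq, not_or, not_not] at h
      exact ht h
    | sUnion S _ ih =>
      rintro ⟨U, hUS, hPU⟩
      exact (ih U hUS hPU).subset fun t ht hU => ht ⟨U, hUS, hU⟩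
  rw [mem_closure_iff]
  intro U hU hPU
  have hfin := (key U hU hPU).union hA
  obtain ⟨t, ht⟩ := hfin.infinite_compl.nonempty
  simp only [Set.mem_compl_iff, Set.mem_union, Set.mem_ofPred_eq, not_or, not_not] at ht
  exact ⟨γ t, ht⟩

lemma isClosed_zeroLocus {d : ℕ} {g : MvPolynomial (Fin 3) ℂ} (hg : g.IsHomogeneous d) :
    IsClosed[zariski 2] (zeroLocus g) := by
  let := zariski 2
  rw [← isOpen_compl_iff]
  exact TopologicalSpace.isOpen_generateFrom_of_mem ⟨d, g, hg, rfl⟩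

lemma eval_aeval_polynomial (p : Fin 3 → Polynomial ℂ) (t : ℂ) (G : MvPolynomial (Fin 3) ℂ) :
    (aeval p G).eval t = eval (fun i => (p i).eval t) G := by
  have := MvPolynomial.eval₂_comp_left (Polynomial.evalRingHom t) Polynomial.C p G
  simp only [Polynomial.coe_evalRingHom] at this
  rw [aeval_def, Polynomial.algebraMap_eq, this]
  congr 1
  ext; simp

/-- A form that vanishes at infinitely many points `p(t)` of a polynomial curve vanishes at
all of them. -/
lemma eval_curve_eq_zero (p : Fin 3 → Polynomial ℂ) (g : MvPolynomial (Fin 3) ℂ)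
    (h : {t : ℂ | eval (fun i => (p i).eval t) g = 0}.Infinite) (t : ℂ) :
    eval (fun i => (p i).eval t) g = 0 := by
  have : aeval p g = 0 := Polynomial.eq_zero_of_infinite_isRoot _ (by
    simpa only [Polynomial.IsRoot, eval_aeval_polynomial] using h)
  rw [← eval_aeval_polynomial, this, Polynomial.eval_zero]

/-- A form vanishing at infinitely many points `v₀ + t v₁ + t² v₂` vanishes at all the points
`s² v₀ + s t v₁ + t² v₂`. -/
lemma eval_quadratic_curve_eq_zero {d : ℕ} {g : MvPolynomial (Fin 3) ℂ} (hg : g.IsHomogeneous d)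
    (v₀ v₁ v₂ : Fin 3 → ℂ) (h : {t : ℂ | eval (v₀ + t • v₁ + t ^ 2 • v₂) g = 0}.Infinite)
    (s t : ℂ) : eval (s ^ 2 • v₀ + (s * t) • v₁ + t ^ 2 • v₂) g = 0 := by
  have h1 : ∀ t : ℂ, eval (v₀ + t • v₁ + t ^ 2 • v₂) g = 0 := by
    let p : Fin 3 → Polynomial ℂ := fun i => Polynomial.C (v₀ i) +
      Polynomial.X * Polynomial.C (v₁ i) + Polynomial.X ^ 2 * Polynomial.C (v₂ i)
    have hp : ∀ t : ℂ, (fun i => (p i).eval t) = v₀ + t • v₁ + t ^ 2 • v₂ := fun t => by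
      ext i; simp [p]; ring
    intro t
    have := eval_curve_eq_zero p g (by simpa only [hp] using h) t
    rwa [hp] at this
  have h2 : ∀ s : ℂ, s ≠ 0 → eval (s ^ 2 • v₀ + (s * t) • v₁ + t ^ 2 • v₂) g = 0 := by
    intro s hs
    have : s ^ 2 • v₀ + (s * t) • v₁ + t ^ 2 • v₂ =
        s ^ 2 • (v₀ + (t / s) • v₁ + (t / s) ^ 2 • v₂) := by
      ext i
      simp only [Pi.add_apply, Pi.smul_apply, smul_eq_mul]
      field_simp
    rw [this, IsHomogeneous.eval_smul hg, h1, mul_zero]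
  -- The remaining case `s = 0` follows by viewing the expression as a polynomial in `s`, which
  -- vanishes at all positive reals.
  let p : Fin 3 → Polynomial ℂ := fun i => Polynomial.X ^ 2 * Polynomial.C (v₀ i) +
    Polynomial.X * Polynomial.C (t * v₁ i) + Polynomial.C (t ^ 2 * v₂ i)
  have hp : ∀ s : ℂ, (fun i => (p i).eval s) = s ^ 2 • v₀ + (s * t) • v₁ + t ^ 2 • v₂ :=
    fun s => by ext i; simp [p]; ring
  have := eval_curve_eq_zero p g ((Set.Ioi_infinite (0 : ℝ)).image
    Complex.ofReal_injective.injOn |>.mono ?_) s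
  · rwa [hp] at this
  · rintro _ ⟨x, hx, rfl⟩
    rw [Set.mem_ofPred_eq, hp]
    exact h2 _ (by simpa using (Set.mem_Ioi.1 hx).ne')

/-! ### Five points lie on the conic -/

section FivePoints

variable {Φ : MvPolynomial (Fin 3) ℂ →ₗ[ℂ] ℂ} {c : MvPolynomial (Fin 3) ℂ} {a : Fin 5 → ℂ}
  {v : Fin 5 → Fin 3 → ℂ}

lemma exists_conic_of_five (v : Fin 5 → Fin 3 → ℂ) :
    ∃ G : MvPolynomial (Fin 3) ℂ, G ≠ 0 ∧ G.IsHomogeneous 2 ∧ ∀ i, eval (v i) G = 0 := by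
  let q : (Fin 6 → ℂ) → MvPolynomial (Fin 3) ℂ := fun k =>
    C (k 0) * X 0 ^ 2 + C (k 1) * X 1 ^ 2 + C (k 2) * X 2 ^ 2 + C (k 3) * (X 0 * X 1) +
      C (k 4) * (X 0 * X 2) + C (k 5) * (X 1 * X 2)
  have hq : ∀ k, (q k).IsHomogeneous 2 := fun k => by
    have h1 : ∀ i : Fin 3, (X i ^ 2 : MvPolynomial (Fin 3) ℂ).IsHomogeneous 2 := fun i =>
      isHomogeneous_X_pow i 2
    have h2 : ∀ i j : Fin 3, (X i * X j : MvPolynomial (Fin 3) ℂ).IsHomogeneous 2 := fun i j =>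
      (isHomogeneous_X ℂ i).mul (isHomogeneous_X ℂ j)
    exact ((((((h1 _).C_mul _).add ((h1 _).C_mul _)).add ((h1 _).C_mul _)).add
      ((h2 _ _).C_mul _)).add ((h2 _ _).C_mul _)).add ((h2 _ _).C_mul _)
  have heval : ∀ k w, eval w (q k) = k 0 * w 0 ^ 2 + k 1 * w 1 ^ 2 + k 2 * w 2 ^ 2 +
      k 3 * (w 0 * w 1) + k 4 * (w 0 * w 2) + k 5 * (w 1 * w 2) := fun k w => by simp [q]
  let φ : (Fin 6 → ℂ) →ₗ[ℂ] (Fin 5 → ℂ) :=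
    { toFun := fun k i => eval (v i) (q k)
      map_add' := fun k l => by ext i; simp only [heval, Pi.add_apply]; ring
      map_smul' := fun r k => by
        ext i; simp only [heval, Pi.smul_apply, smul_eq_mul, RingHom.id_apply]; ring }
  -- Six coefficients against five vanishing conditions.
  obtain ⟨k, hk, hk0⟩ := (Submodule.ne_bot_iff _).1
    (LinearMap.ker_ne_bot_of_finrank_lt (f := φ) (by simp))
  refine ⟨q k, fun h0 => hk0 ?_, hq k, fun i => congrFun (LinearMap.mem_ker.1 hk) i⟩
  have h := fun w => heval k w
  simp only [h0, map_zero] at h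
  have e0 := h ![1, 0, 0]
  have e1 := h ![0, 1, 0]
  have e2 := h ![0, 0, 1]
  have e3 := h ![1, 1, 0]
  have e4 := h ![1, 0, 1]
  have e5 := h ![0, 1, 1]
  simp at e0 e1 e2 e3 e4 e5
  ext i
  fin_cases i <;> simp <;> grind

/-- The conic spanning the radical is nonzero and contains the points of a decomposition. -/
lemma IsRadical.eval_eq_zero (hc : IsRadical Φ c) (h : IsDecomp Φ a v) :
    c ≠ 0 ∧ ∀ i, eval (v i) c = 0 := by
  obtain ⟨G, hG0, hG, hGv⟩ := exists_conic_of_five v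
  obtain ⟨k, rfl⟩ := (hc G hG).1 fun H hH => by
    rw [h _ (hG.mul hH)]
    simp [hGv]
  have hk : k ≠ 0 := fun hk => hG0 (by simp [hk])
  refine ⟨fun hc0 => hG0 (by simp [hc0]), fun i => ?_⟩
  simpa [smul_eval, hk] using hGv i

/-- The points of a decomposition do not lie on a line. -/
lemma IsRadical.linear_eq_zero (hc : IsRadical Φ c) (h : IsDecomp Φ a v)
    {l : MvPolynomial (Fin 3) ℂ} (hl : l.IsHomogeneous 1) (hlv : ∀ i, eval (v i) l = 0) :
    l = 0 := by
  -- If `l` vanishes at all nodes, every `l * X j` lies in the radical. These products span more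
  -- than one dimension unless `l = 0`.
  have hX : ∀ j, ∃ k : ℂ, l * X j = k • c := fun j =>
    (hc _ (hl.mul (isHomogeneous_X ℂ j))).1 fun H hH => by
      rw [h _ ((hl.mul (isHomogeneous_X ℂ j)).mul hH)]
      simp [hlv]
  obtain ⟨k₀, h0⟩ := hX 0
  obtain ⟨k₁, h1⟩ := hX 1
  by_contra hl0
  have h2 : l * (C k₁ * X 0 - C k₀ * X 1) = 0 := by
    rw [smul_eq_C_mul] at h0 h1
    linear_combination C k₁ * h0 - C k₀ * h1
  have h3 := (mul_eq_zero.1 h2).resolve_left hl0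
  have h4 := congrArg (eval ![0, 1, 0]) h3
  simp at h4
  rw [h4, zero_smul] at h0
  exact (mul_ne_zero hl0 (X_ne_zero 0)) h0

end FivePoints

/-! ### Normal forms of conics -/

/-- Three linearly independent linear forms are the coordinates of a frame. -/
lemma exists_frame {a : Fin 3 → Fin 3 → ℂ} (ha : LinearIndependent ℂ a) :
    ∃ e : (Fin 3 → ℂ) ≃ₗ[ℂ] (Fin 3 → ℂ),
      ∀ i, linSubst (e : (Fin 3 → ℂ) →ₗ[ℂ] (Fin 3 → ℂ)) (vecForm (a i)) = X i := by
  let A : Matrix (Fin 3) (Fin 3) ℂ := Matrix.of a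
  have hA : IsUnit A := Matrix.linearIndependent_rows_iff_isUnit.1 ha
  have hinj : LinearMap.ker A.mulVecLin = ⊥ := by
    rw [LinearMap.ker_eq_bot]
    exact Matrix.mulVec_injective_of_isUnit hA
  let E := LinearEquiv.ofInjectiveEndo A.mulVecLin (LinearMap.ker_eq_bot.1 hinj)
  refine ⟨E.symm, fun i => MvPolynomial.funext fun v => ?_⟩
  rw [eval_linSubst, eval_X, eval_vecForm]
  have : E (E.symm v) i = v i := by rw [LinearEquiv.apply_symm_apply]
  rw [← this]
  rfl

lemma vecForm_add_smul (r s : ℂ) (a b : Fin 3 → ℂ) :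
    vecForm (r • a + s • b) = r • vecForm a + s • vecForm b := by
  simp only [vecForm, Finset.smul_sum, ← Finset.sum_add_distrib, smul_eq_C_mul]
  refine Finset.sum_congr rfl fun i _ => ?_
  simp
  ring

/-- Two linear forms without common line are part of a frame, if not all nodes of
a decomposition lie on one line. -/
lemma exists_frame_of_mul {Φ : MvPolynomial (Fin 3) ℂ →ₗ[ℂ] ℂ} {a : Fin 5 → ℂ}
    {v : Fin 5 → Fin 3 → ℂ} {l₁ l₂ : MvPolynomial (Fin 3) ℂ} (h₁ : l₁.IsHomogeneous 1)
    (h₂ : l₂.IsHomogeneous 1) (hc : IsRadical Φ (l₁ * l₂)) (h : IsDecomp Φ a v) :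
    ∃ e : (Fin 3 → ℂ) ≃ₗ[ℂ] (Fin 3 → ℂ),
      linSubst (e : (Fin 3 → ℂ) →ₗ[ℂ] (Fin 3 → ℂ)) l₁ = X 0 ∧
      linSubst (e : (Fin 3 → ℂ) →ₗ[ℂ] (Fin 3 → ℂ)) l₂ = X 1 := by
  obtain ⟨hne, hev⟩ := hc.eval_eq_zero h
  obtain ⟨a₁, rfl⟩ := exists_eq_vecForm h₁
  obtain ⟨a₂, rfl⟩ := exists_eq_vecForm h₂
  have hv0 : vecForm 0 = 0 := by simp [vecForm]
  have ha₁ : a₁ ≠ 0 := by rintro rfl; simp [hv0] at hne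
  have ha₂ : a₂ ≠ 0 := by rintro rfl; simp [hv0] at hne
  have hli : LinearIndependent ℂ ![a₁, a₂] := by
    rw [LinearIndependent.pair_iff' ha₁]
    intro k hk
    have hk' : vecForm a₂ = k • vecForm a₁ := by
      have := vecForm_add_smul k 0 a₁ 0
      simpa [hk] using this
    -- Proportional factors would make the conic a double line containing all the nodes.
    have : vecForm a₁ = 0 := hc.linear_eq_zero h h₁ fun i => by
      have := hev i
      rw [map_mul, hk', smul_eval] at this
      have hk0 : k ≠ 0 := by rintro rfl; simp at hk; exact ha₂ hk.symm
      simpa [hk0] using this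
    simp [this] at hne
  obtain ⟨a₃, ha₃⟩ := exists_linearIndependent_snoc_of_lt_finrank hli (by simp)
  have hs : (Fin.snoc ![a₁, a₂] a₃ : Fin 3 → Fin 3 → ℂ) = ![a₁, a₂, a₃] := by
    ext i j
    fin_cases i <;> rfl
  rw [hs] at ha₃
  obtain ⟨e, he⟩ := exists_frame ha₃
  exact ⟨e, he 0, he 1⟩

/-- A reducible quadratic form is a product of linear forms. -/
lemma exists_linear_factors {c : MvPolynomial (Fin 3) ℂ} (hc : c.IsHomogeneous 2) (hc0 : c ≠ 0)
    (h : ¬ Irreducible c) : ∃ l₁ l₂ : MvPolynomial (Fin 3) ℂ,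
      l₁.IsHomogeneous 1 ∧ l₂.IsHomogeneous 1 ∧ c = l₁ * l₂ := by
  have hunit : ∀ p : MvPolynomial (Fin 3) ℂ, p ≠ 0 → p.totalDegree = 0 → IsUnit p := by
    intro p hp0 hp
    rw [totalDegree_eq_zero_iff_eq_C] at hp
    rw [hp]
    refine IsUnit.map C (isUnit_iff_ne_zero.2 fun h0 => hp0 ?_)
    rw [hp, h0, C_0]
  have hnu : ¬ IsUnit c := by
    intro hu
    have := (isUnit_iff_totalDegree_of_isReduced.1 hu).2
    rw [hc.totalDegree hc0] at this
    omega
  rw [irreducible_iff, not_and] at h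
  have h' := h hnu
  push Not at h'
  obtain ⟨p, q, rfl, hp, hq⟩ := h'
  have hp0 : p ≠ 0 := left_ne_zero_of_mul hc0
  have hq0 : q ≠ 0 := right_ne_zero_of_mul hc0
  have hdeg := totalDegree_mul_of_isDomain hp0 hq0
  rw [hc.totalDegree hc0] at hdeg
  have hpd : p.totalDegree ≠ 0 := fun h => hp (hunit p hp0 h)
  have hqd : q.totalDegree ≠ 0 := fun h => hq (hunit q hq0 h)
  have hsplit : ∀ p : MvPolynomial (Fin 3) ℂ, p.totalDegree = 1 →
      p = homogeneousComponent 0 p + homogeneousComponent 1 p := fun p hp => by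
    have := sum_homogeneousComponent p
    rw [hp, Finset.sum_range_succ, Finset.sum_range_one] at this
    exact this.symm
  refine ⟨homogeneousComponent 1 p, homogeneousComponent 1 q,
    homogeneousComponent_isHomogeneous _ _, homogeneousComponent_isHomogeneous _ _, ?_⟩
  have hp2 := hsplit p (by omega)
  have hq2 := hsplit q (by omega)
  set p₀ := homogeneousComponent 0 p
  set p₁ := homogeneousComponent 1 p
  set q₀ := homogeneousComponent 0 q
  set q₁ := homogeneousComponent 1 q
  have e0 : (p₀ * q₀).IsHomogeneous 0 :=
    (homogeneousComponent_isHomogeneous _ _).mul (homogeneousComponent_isHomogeneous _ _)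
  have e1 : (p₀ * q₁ + p₁ * q₀).IsHomogeneous 1 := by
    have h1 := (homogeneousComponent_isHomogeneous 0 p).mul
      (homogeneousComponent_isHomogeneous 1 q)
    have h2 := (homogeneousComponent_isHomogeneous 1 p).mul
      (homogeneousComponent_isHomogeneous 0 q)
    rw [zero_add] at h1
    rw [add_zero] at h2
    exact h1.add h2
  have e2 : (p₁ * q₁).IsHomogeneous 2 :=
    (homogeneousComponent_isHomogeneous _ _).mul (homogeneousComponent_isHomogeneous _ _)
  have hpq : p * q = p₀ * q₀ + (p₀ * q₁ + p₁ * q₀) + p₁ * q₁ := by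
    rw [hp2, hq2]; ring
  -- The product is homogeneous of degree 2, so it equals the product of the linear parts of its
  -- factors.
  have := congrArg (homogeneousComponent 2) hpq
  rw [map_add, map_add, homogeneousComponent_of_mem ((mem_homogeneousSubmodule _ _).2 e0),
    homogeneousComponent_of_mem ((mem_homogeneousSubmodule _ _).2 e1),
    homogeneousComponent_of_mem ((mem_homogeneousSubmodule _ _).2 e2),
    homogeneousComponent_of_mem ((mem_homogeneousSubmodule _ _).2 hc)] at this
  simpa using this

/-- The quadratic form attached to a homogeneous polynomial of degree `2`. -/
noncomputable def quadForm (c : MvPolynomial (Fin 3) ℂ) (hc : c.IsHomogeneous 2) :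
    QuadraticForm ℂ (Fin 3 → ℂ) :=
  QuadraticMap.ofPolar (fun v => eval v c)
    (fun k v => by rw [IsHomogeneous.eval_smul hc, pow_two]; rfl)
    (fun u v w => by
      let E : (Fin 3 → ℂ) → MvPolynomial (Fin 3) ℂ →ₗ[ℂ] ℂ := fun v =>
        (aeval v : MvPolynomial (Fin 3) ℂ →ₐ[ℂ] ℂ).toLinearMap
      have := homogeneous_ext (φ := E (u + v + w) - E (u + v) - E w)
        (ψ := (E (u + w) - E u - E w) + (E (v + w) - E v - E w)) ?_ hc
      · simpa [E, aeval_eq_eval, QuadraticMap.polar] using this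
      · intro a b c habc
        have ha : a ≤ 2 := by omega
        have hb : b ≤ 2 := by omega
        obtain rfl : c = 2 - a - b := by omega
        interval_cases a <;> interval_cases b <;> first | omega | (simp [E]; ring))
    (fun k u v => by
      let E : (Fin 3 → ℂ) → MvPolynomial (Fin 3) ℂ →ₗ[ℂ] ℂ := fun v =>
        (aeval v : MvPolynomial (Fin 3) ℂ →ₐ[ℂ] ℂ).toLinearMap
      have := homogeneous_ext (φ := E (k • u + v) - E (k • u) - E v)
        (ψ := k • (E (u + v) - E u - E v)) ?_ hc
      · simpa [E, aeval_eq_eval, QuadraticMap.polar] using this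
      · intro a b c habc
        have ha : a ≤ 2 := by omega
        have hb : b ≤ 2 := by omega
        obtain rfl : c = 2 - a - b := by omega
        interval_cases a <;> interval_cases b <;> first | omega | (simp [E]; ring))

/-- A quadratic form is a weighted sum of squares of independent linear forms. -/
lemma exists_eq_sum_squares {c : MvPolynomial (Fin 3) ℂ} (hc : c.IsHomogeneous 2) :
    ∃ (e : (Fin 3 → ℂ) ≃ₗ[ℂ] (Fin 3 → ℂ)) (w : Fin 3 → ℂ),
      linSubst (e : (Fin 3 → ℂ) →ₗ[ℂ] (Fin 3 → ℂ)) c = ∑ i, C (w i) * X i ^ 2 := by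
  obtain ⟨w, ⟨e⟩⟩ := (quadForm c hc).equivalent_weightedSumSquares
  have hn : Module.finrank ℂ (Fin 3 → ℂ) = 3 := by simp
  generalize Module.finrank ℂ (Fin 3 → ℂ) = n at hn w e
  subst hn
  refine ⟨e.toLinearEquiv.symm, w, MvPolynomial.funext fun v => ?_⟩
  rw [eval_linSubst]
  have h := e.symm.map_app v
  rw [QuadraticMap.weightedSumSquares_apply] at h
  change eval (e.symm v) c = _ at h
  change eval (e.symm v) c = _
  rw [h]
  simp [pow_two]

/-- An irreducible quadratic form is `X₀ X₂ - X₁²` in a suitable frame. -/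
lemma exists_frame_of_irreducible {c : MvPolynomial (Fin 3) ℂ} (hc : c.IsHomogeneous 2)
    (h : Irreducible c) : ∃ e : (Fin 3 → ℂ) ≃ₗ[ℂ] (Fin 3 → ℂ),
      linSubst (e : (Fin 3 → ℂ) →ₗ[ℂ] (Fin 3 → ℂ)) c = X 0 * X 2 - X 1 ^ 2 := by
  obtain ⟨e, w, he⟩ := exists_eq_sum_squares hc
  have hsq : ∀ i, ∃ r : ℂ, r ^ 2 = w i := fun i => IsAlgClosed.exists_pow_nat_eq _ two_pos
  choose r hr using hsq
  have hnu : ∀ l : MvPolynomial (Fin 3) ℂ, l.IsHomogeneous 1 → ¬ IsUnit l := by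
    intro l hl hu
    have h1 := IsHomogeneous.eval_smul hl 0 0
    rw [zero_smul, pow_one, zero_mul] at h1
    have h2 := hu.map (eval (0 : Fin 3 → ℂ))
    rw [h1] at h2
    exact not_isUnit_zero h2
  have hnl : ∀ i j : Fin 3, ∀ s t : ℂ, linSubst (e : (Fin 3 → ℂ) →ₗ[ℂ] (Fin 3 → ℂ)) c ≠
      (C s * X i + C t * X j) * (C s * X i - C t * X j) := by
    intro i j s t heq
    have h1 := congrArg (linSubst (e.symm : (Fin 3 → ℂ) →ₗ[ℂ] (Fin 3 → ℂ))) heq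
    rw [linSubst_symm_linSubst, map_mul] at h1
    have hs := isHomogeneous_C_mul_X s i
    have ht := isHomogeneous_C_mul_X t j
    exact (h.isUnit_or_isUnit h1).elim (hnu _ (isHomogeneous_linSubst _ (hs.add ht)))
      (hnu _ (isHomogeneous_linSubst _ (hs.sub ht)))
  -- With a vanishing weight only two squares remain, and over `ℂ` a sum of two squares factors.
  have hr0 : ∀ i, r i ≠ 0 := by
    intro i hi
    have key : ∀ j k : Fin 3, (∀ v : Fin 3 → ℂ, ∑ m, w m * v m ^ 2 =
        w i * v i ^ 2 + w j * v j ^ 2 + w k * v k ^ 2) → False := by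
      intro j k hjk
      refine hnl j k (r j) (Complex.I * r k) (he.trans (MvPolynomial.funext fun v => ?_))
      simp only [map_sum, map_mul, map_pow, eval_C, eval_X, map_add, map_sub]
      rw [hjk, ← hr, ← hr, ← hr, hi]
      linear_combination (r k ^ 2 * v k ^ 2) * Complex.I_sq
    fin_cases i
    · exact key 1 2 fun v => by rw [Fin.sum_univ_three]; rfl
    · exact key 0 2 fun v => by rw [Fin.sum_univ_three]; simp; ring
    · exact key 0 1 fun v => by rw [Fin.sum_univ_three]; simp; ring
  have hI := Complex.I_ne_zero
  have h0 := hr0 0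
  have h1 := hr0 1
  have h2 := hr0 2
  -- Chosen so that `r₀u₀`, `I r₁u₁`, `I r₂u₂` become `(v₀ + v₂)/2`, `(v₀ - v₂)/2`, `v₁`; the sum of
  -- the `rᵢ²uᵢ²` is then `v₀v₂ - v₁²`.
  let N : (Fin 3 → ℂ) ≃ₗ[ℂ] (Fin 3 → ℂ) :=
    { toFun := fun v => ![(v 0 + v 2) / (2 * r 0), (v 0 - v 2) / (2 * Complex.I * r 1),
        v 1 / (Complex.I * r 2)]
      invFun := fun u => ![r 0 * u 0 + Complex.I * r 1 * u 1, Complex.I * r 2 * u 2,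
        r 0 * u 0 - Complex.I * r 1 * u 1]
      map_add' := fun u v => by ext i; fin_cases i <;> simp <;> ring
      map_smul' := fun k v => by ext i; fin_cases i <;> simp <;> ring
      left_inv := fun v => by ext i; fin_cases i <;> simp <;> field_simp <;> ring
      right_inv := fun v => by ext i; fin_cases i <;> simp <;> field_simp <;> ring }
  refine ⟨N.trans e, MvPolynomial.funext fun v => ?_⟩
  have hN : N v = ![(v 0 + v 2) / (2 * r 0), (v 0 - v 2) / (2 * Complex.I * r 1),
        v 1 / (Complex.I * r 2)] := rfl
  rw [eval_linSubst, LinearEquiv.coe_coe, LinearEquiv.trans_apply, ← LinearEquiv.coe_coe,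
    ← eval_linSubst, he, hN, Fin.sum_univ_three, ← hr, ← hr, ← hr]
  simp
  field_simp
  rw [Complex.I_sq]
  ring

/-! ### The case of a smooth conic -/

lemma basisMonomials_eq_X_pow (k : ℕ) :
    Polynomial.basisMonomials ℂ k = Polynomial.X ^ k := by
  rw [Polynomial.coe_basisMonomials]
  exact Polynomial.monomial_one_right_eq_X_pow k

/-- The linear map that sends `X ^ k` to a monomial restricting to it on the standard conic. -/
noncomputable def conicLift (d : ℕ) : Polynomial ℂ →ₗ[ℂ] MvPolynomial (Fin 3) ℂ :=
  (Polynomial.basisMonomials ℂ).constr ℂ fun k =>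
    -- The exponents add up to `d` because `k % 2 + k / 2 = (k + 1) / 2`; the subtraction truncates
    -- only for `k > 2d`.
    X 0 ^ (d - (k + 1) / 2) * X 1 ^ (k % 2) * X 2 ^ (k / 2)

lemma conicLift_X_pow (d k : ℕ) : conicLift d (Polynomial.X ^ k) =
    X 0 ^ (d - (k + 1) / 2) * X 1 ^ (k % 2) * X 2 ^ (k / 2) := by
  have := (Polynomial.basisMonomials ℂ).constr_basis ℂ (fun k =>
    (X 0 ^ (d - (k + 1) / 2) * X 1 ^ (k % 2) * X 2 ^ (k / 2) : MvPolynomial (Fin 3) ℂ)) k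
  rwa [basisMonomials_eq_X_pow] at this

/-- Restriction of forms to the standard conic. -/
noncomputable def conicRestrict : MvPolynomial (Fin 3) ℂ →ₐ[ℂ] Polynomial ℂ :=
  aeval ![1, Polynomial.X, Polynomial.X ^ 2]

lemma eval_conicRestrict (t : ℂ) (G : MvPolynomial (Fin 3) ℂ) :
    (conicRestrict G).eval t = eval ![1, t, t ^ 2] G := by
  rw [conicRestrict, eval_aeval_polynomial]
  congr 2
  ext i
  fin_cases i <;> simp

lemma conicRestrict_monomial (a b c : ℕ) :
    conicRestrict (X 0 ^ a * X 1 ^ b * X 2 ^ c) = Polynomial.X ^ (b + 2 * c) := by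
  simp [conicRestrict, ← pow_mul, ← pow_add]

lemma conicRestrict_conicLift (d : ℕ) (p : Polynomial ℂ) :
    conicRestrict (conicLift d p) = p := by
  have : conicRestrict.toLinearMap ∘ₗ conicLift d = LinearMap.id := by
    refine (Polynomial.basisMonomials ℂ).ext fun k => ?_
    rw [basisMonomials_eq_X_pow,
      LinearMap.comp_apply, conicLift_X_pow, AlgHom.toLinearMap_apply, conicRestrict_monomial,
      Nat.mod_add_div, LinearMap.id_apply]
  exact LinearMap.congr_fun this p

lemma isHomogeneous_conicLift {d : ℕ} {p : Polynomial ℂ} (hp : p.natDegree ≤ 2 * d) :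
    (conicLift d p).IsHomogeneous d := by
  rw [p.as_sum_range_C_mul_X_pow' (Nat.lt_succ_iff.2 hp), map_sum]
  refine IsHomogeneous.sum _ _ _ fun k hk => ?_
  rw [← Polynomial.smul_eq_C_mul, map_smul, conicLift_X_pow, smul_eq_C_mul]
  refine IsHomogeneous.C_mul ?_ _
  have := ((isHomogeneous_X_pow (R := ℂ) (0 : Fin 3) (d - (k + 1) / 2)).mul
    (isHomogeneous_X_pow 1 (k % 2))).mul (isHomogeneous_X_pow 2 (k / 2))
  have hk' := Finset.mem_range.1 hk
  rwa [show d - (k + 1) / 2 + k % 2 + k / 2 = d by omega] at this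

/-- Degree bound for the restriction of a form to a curve, checked on monomials. -/
lemma natDegree_le_of_monomial {d n : ℕ} (ρ : MvPolynomial (Fin 3) ℂ →ₗ[ℂ] Polynomial ℂ)
    (hρ : ∀ a b c : ℕ, a + b + c = d → (ρ (X 0 ^ a * X 1 ^ b * X 2 ^ c)).natDegree ≤ n)
    {G : MvPolynomial (Fin 3) ℂ} (hG : G.IsHomogeneous d) : (ρ G).natDegree ≤ n := by
  have h := homogeneous_ext (φ := (Polynomial.degreeLE ℂ n).mkQ ∘ₗ ρ) (ψ := 0) (fun a b c habc => by
    rw [LinearMap.comp_apply, LinearMap.zero_apply, Submodule.mkQ_apply,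
      Submodule.Quotient.mk_eq_zero, Polynomial.mem_degreeLE]
    exact Polynomial.natDegree_le_iff_degree_le.1 (hρ a b c habc)) hG
  rw [LinearMap.comp_apply, LinearMap.zero_apply, Submodule.mkQ_apply,
    Submodule.Quotient.mk_eq_zero, Polynomial.mem_degreeLE] at h
  exact Polynomial.natDegree_le_iff_degree_le.2 h

variable {Φ : MvPolynomial (Fin 3) ℂ →ₗ[ℂ] ℂ}

lemma IsRadical.apply_mul {c : MvPolynomial (Fin 3) ℂ} (hc : IsRadical Φ c)
    (hc2 : c.IsHomogeneous 2) {H : MvPolynomial (Fin 3) ℂ} (hH : H.IsHomogeneous 2) :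
    Φ (c * H) = 0 :=
  (hc c hc2).2 ⟨1, (one_smul _ _).symm⟩ H hH

lemma isHomogeneous_monomial_three (a b c : ℕ) :
    (X 0 ^ a * X 1 ^ b * X 2 ^ c : MvPolynomial (Fin 3) ℂ).IsHomogeneous (a + b + c) :=
  ((isHomogeneous_X_pow 0 a).mul (isHomogeneous_X_pow 1 b)).mul (isHomogeneous_X_pow 2 c)

lemma isHomogeneous_standard_conic :
    (X 0 * X 2 - X 1 ^ 2 : MvPolynomial (Fin 3) ℂ).IsHomogeneous 2 :=
  ((isHomogeneous_X ℂ 0).mul (isHomogeneous_X ℂ 2)).sub (isHomogeneous_X_pow 1 2)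

/-- Multiples of the conic are killed by `Φ`, so `X₁²` may be replaced by `X₀X₂` until the exponent
of `X₁` is 0 or 1. Thus `Φ` depends only on the restriction to the conic. -/
lemma apply_eq_conicLift (hΦ : IsRadical Φ (X 0 * X 2 - X 1 ^ 2)) {G : MvPolynomial (Fin 3) ℂ}
    (hG : G.IsHomogeneous 4) : Φ G = Φ (conicLift 4 (conicRestrict G)) := by
  have hred : ∀ b a c : ℕ, a + b + c = 4 → Φ (X 0 ^ a * X 1 ^ b * X 2 ^ c) =
      Φ (X 0 ^ (a + b / 2) * X 1 ^ (b % 2) * X 2 ^ (c + b / 2)) := by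
    intro b
    induction b using Nat.twoStepInduction with
    | zero => simp
    | one => simp
    | more b ih _ =>
      intro a c habc
      have h1 := ih (a + 1) (c + 1) (by omega)
      have h2 := hΦ.apply_mul isHomogeneous_standard_conic
        (H := X 0 ^ a * X 1 ^ b * X 2 ^ c) (by
          have := isHomogeneous_monomial_three a b c
          rwa [show a + b + c = 2 by omega] at this)
      have h3 : (X 0 * X 2 - X 1 ^ 2) * (X 0 ^ a * X 1 ^ b * X 2 ^ c) =
          X 0 ^ (a + 1) * X 1 ^ b * X 2 ^ (c + 1) -
            (X 0 ^ a * X 1 ^ (b + 2) * X 2 ^ c : MvPolynomial (Fin 3) ℂ) := by ring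
      rw [h3, map_sub, sub_eq_zero] at h2
      rw [← h2, h1, show a + 1 + b / 2 = a + (b + 2) / 2 by omega,
        show c + 1 + b / 2 = c + (b + 2) / 2 by omega, Nat.add_mod_right]
  refine homogeneous_ext (φ := Φ)
    (ψ := Φ ∘ₗ conicLift 4 ∘ₗ conicRestrict.toLinearMap) (fun a b c habc => ?_) hG
  simp only [LinearMap.comp_apply, AlgHom.toLinearMap_apply]
  rw [conicRestrict_monomial, conicLift_X_pow, hred b a c habc]
  congr 4 <;> omega

/-- If the radical of `Φ` is spanned by the standard conic, almost all of its points are nodes. -/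
theorem finite_not_mem_nodeSet_conic (hΦ : IsRadical Φ (X 0 * X 2 - X 1 ^ 2)) :
    {t : ℂ | ![1, t, t ^ 2] ∉ nodeSet Φ}.Finite := by
  have hdeg : ∀ {d : ℕ} {G : MvPolynomial (Fin 3) ℂ}, G.IsHomogeneous d →
      (conicRestrict G).natDegree ≤ 2 * d := fun {d G} hG =>
    natDegree_le_of_monomial conicRestrict.toLinearMap (fun a b c habc => by
      rw [AlgHom.toLinearMap_apply, conicRestrict_monomial, Polynomial.natDegree_X_pow]
      omega) hG
  have hL := Polynomial.finite_not_node (L := Φ ∘ₗ conicLift 4) (m := 4) (fun p hp h => ?_)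
  · refine hL.subset fun t ht => ?_
    rintro ⟨x, a, rfl, hx⟩
    refine ht ⟨a, fun i => ![1, x i, x i ^ 2], fun G hG => ?_, fun i h0 => ?_, 0, rfl⟩
    · rw [apply_eq_conicLift hΦ hG]
      refine (hx _ (hdeg hG)).trans (Finset.sum_congr rfl fun i _ => ?_)
      rw [eval_conicRestrict]
    · simpa using congrFun h0 0
  -- A polynomial in the Hankel kernel lifts to a quadric in the radical, hence to a multiple of the
  -- conic, and this restricts to 0.
  · have hG := isHomogeneous_conicLift (d := 2) hp
    obtain ⟨k, hk⟩ := (hΦ _ hG).1 fun H hH => by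
      rw [apply_eq_conicLift hΦ (hG.mul hH), map_mul, conicRestrict_conicLift]
      exact h _ (hdeg hH)
    have := congrArg conicRestrict hk
    rw [conicRestrict_conicLift] at this
    rw [this]
    simp [conicRestrict]

/-! ### The case of two lines -/

variable {Φ : MvPolynomial (Fin 3) ℂ →ₗ[ℂ] ℂ}

/-- Up to the value at `X₂ ^ 4`, the restriction of `Φ` to the line spanned by the `i`-th and the
last coordinate vector is a combination of two evaluations. -/
def IsBinodal (Φ : MvPolynomial (Fin 3) ℂ →ₗ[ℂ] ℂ) (i : Fin 3) : Prop :=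
  ∃ s₁ s₂ c₁ c₂ : ℂ, s₁ ≠ s₂ ∧ c₁ ≠ 0 ∧ c₂ ≠ 0 ∧
    ∀ k ≤ 3, Φ (X i ^ (4 - k) * X 2 ^ k) = c₁ * s₁ ^ k + c₂ * s₂ ^ k

lemma isHomogeneous_two_lines : (X 0 * X 1 : MvPolynomial (Fin 3) ℂ).IsHomogeneous 2 :=
  (isHomogeneous_X ℂ 0).mul (isHomogeneous_X ℂ 1)

/-- Functionals that agree on the multiples of `X₀ X₁` are determined on quartic forms by their
values at the monomials of the two lines. -/
lemma apply_eq_of_two_lines {φ ψ : MvPolynomial (Fin 3) ℂ →ₗ[ℂ] ℂ}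
    (h : ∀ H : MvPolynomial (Fin 3) ℂ, H.IsHomogeneous 2 → φ (X 0 * X 1 * H) = ψ (X 0 * X 1 * H))
    (h0 : ∀ k ≤ 3, φ (X 0 ^ (4 - k) * X 2 ^ k) = ψ (X 0 ^ (4 - k) * X 2 ^ k))
    (h1 : ∀ k ≤ 3, φ (X 1 ^ (4 - k) * X 2 ^ k) = ψ (X 1 ^ (4 - k) * X 2 ^ k))
    (h2 : φ (X 2 ^ 4) = ψ (X 2 ^ 4)) {G : MvPolynomial (Fin 3) ℂ} (hG : G.IsHomogeneous 4) :
    φ G = ψ G := by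
  refine homogeneous_ext (fun a b c habc => ?_) hG
  rcases a with - | a
  · rcases b with - | b
    · obtain rfl : c = 4 := by omega
      simpa using h2
    · have := h1 c (by omega)
      rw [show 4 - c = b + 1 by omega] at this
      simpa using this
  · rcases b with - | b
    · have := h0 c (by omega)
      rw [show 4 - c = a + 1 by omega] at this
      simpa using this
    · have := h (X 0 ^ a * X 1 ^ b * X 2 ^ c) (by
        have := isHomogeneous_monomial_three a b c
        rwa [show a + b + c = 2 by omega] at this)
      rwa [show X 0 * X 1 * (X 0 ^ a * X 1 ^ b * X 2 ^ c) =
        (X 0 ^ (a + 1) * X 1 ^ (b + 1) * X 2 ^ c : MvPolynomial (Fin 3) ℂ) by ring] at this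

/-- With a single node of slope `s`, the quadric `X₀(X₂ - sX₀)` would join the radical, although it
is not a multiple of `X₀X₁`. -/
lemma not_single_node (hΦ : IsRadical Φ (X 0 * X 1)) :
    ¬ ∃ c s : ℂ, ∀ k ≤ 3, Φ (X 0 ^ (4 - k) * X 2 ^ k) = c * s ^ k := by
  rintro ⟨c, s, h⟩
  have hG : (X 0 * (X 2 - C s * X 0) : MvPolynomial (Fin 3) ℂ).IsHomogeneous 2 :=
    (isHomogeneous_X ℂ 0).mul ((isHomogeneous_X ℂ 2).sub (isHomogeneous_C_mul_X s 0))
  obtain ⟨k, hk⟩ := (hΦ _ hG).1 fun H hH => by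
    refine homogeneous_ext (φ := Φ ∘ₗ LinearMap.mulLeft ℂ (X 0 * (X 2 - C s * X 0))) (ψ := 0)
      (fun a b e habe => ?_) hH
    rw [LinearMap.comp_apply, LinearMap.mulLeft_apply, LinearMap.zero_apply]
    rcases b with - | b
    · have h1 := h e (by omega)
      have h2 := h (e + 1) (by omega)
      rw [show 4 - e = a + 2 by omega] at h1
      rw [show 4 - (e + 1) = a + 1 by omega] at h2
      rw [show X 0 * (X 2 - C s * X 0) * (X 0 ^ a * X 1 ^ 0 * X 2 ^ e) =
        (X 0 ^ (a + 1) * X 2 ^ (e + 1) - s • (X 0 ^ (a + 2) * X 2 ^ e) :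
          MvPolynomial (Fin 3) ℂ) by rw [smul_eq_C_mul]; ring, map_sub, map_smul, h1, h2,
        smul_eq_mul]
      ring
    · have h1 := hΦ.apply_mul isHomogeneous_two_lines
        (H := (X 2 - C s * X 0) * (X 0 ^ a * X 1 ^ b * X 2 ^ e)) (by
          have := ((isHomogeneous_X ℂ (2 : Fin 3)).sub (isHomogeneous_C_mul_X s 0)).mul
            (isHomogeneous_monomial_three a b e)
          rwa [show 1 + (a + b + e) = 2 by omega] at this)
      rw [← h1]
      congr 1
      ring
  -- At this point `X₀X₁` vanishes while the quadric takes the value 1.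
  have := congrArg (eval ![1, 0, s + 1]) hk
  simp [smul_eval] at this

/-- The quadratic form whose zeros are the nodes of a binodal line. -/
noncomputable def nodalForm (Φ : MvPolynomial (Fin 3) ℂ →ₗ[ℂ] ℂ) : MvPolynomial (Fin 3) ℂ :=
  C (Φ (X 0 ^ 4) * Φ (X 0 ^ 2 * X 2 ^ 2) - Φ (X 0 ^ 3 * X 2) ^ 2) * X 2 ^ 2 -
    C (Φ (X 0 ^ 4) * Φ (X 0 * X 2 ^ 3) - Φ (X 0 ^ 3 * X 2) * Φ (X 0 ^ 2 * X 2 ^ 2)) *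
      (X 0 * X 2) +
    C (Φ (X 0 ^ 3 * X 2) * Φ (X 0 * X 2 ^ 3) - Φ (X 0 ^ 2 * X 2 ^ 2) ^ 2) * X 0 ^ 2

lemma isHomogeneous_nodalForm : (nodalForm Φ).IsHomogeneous 2 :=
  (((isHomogeneous_X_pow 2 2).C_mul _).sub
    (((isHomogeneous_X ℂ 0).mul (isHomogeneous_X ℂ 2)).C_mul _)).add
    ((isHomogeneous_X_pow 0 2).C_mul _)

/-- With `m_k = Φ(X₀^(4-k) X₂^k)`, the coefficients of the form are the signed maximal minors of the
Hankel matrix with rows `(m₀, m₁, m₂)` and `(m₁, m₂, m₃)`. Its zeros on the line are therefore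
determined by `Φ` alone, whichever decomposition is used. -/
lemma eval_nodalForm {s₁ s₂ c₁ c₂ : ℂ}
    (h : ∀ k ≤ 3, Φ (X 0 ^ (4 - k) * X 2 ^ k) = c₁ * s₁ ^ k + c₂ * s₂ ^ k) (v : Fin 3 → ℂ) :
    eval v (nodalForm Φ) =
      c₁ * c₂ * (s₁ - s₂) ^ 2 * ((v 2 - s₁ * v 0) * (v 2 - s₂ * v 0)) := by
  have h0 := h 0 (by omega)
  have h1 := h 1 (by omega)
  have h2 := h 2 (by omega)
  have h3 := h 3 (by omega)
  norm_num at h0 h1 h2 h3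
  simp only [nodalForm, h0, h1, h2, h3, map_add, map_sub, map_mul, map_pow, eval_C, eval_X]
  ring

lemma apply_line_of_isDecomp {a : Fin 5 → ℂ} {v : Fin 5 → Fin 3 → ℂ} (h : IsDecomp Φ a v) {k : ℕ}
    (hk : k ≤ 3) : Φ (X 0 ^ (4 - k) * X 2 ^ k) =
      ∑ i with v i 0 ≠ 0, a i * v i 0 ^ 4 * (v i 2 / v i 0) ^ k := by
  have hG : (X 0 ^ (4 - k) * X 2 ^ k : MvPolynomial (Fin 3) ℂ).IsHomogeneous 4 := by
    have := (isHomogeneous_X_pow (R := ℂ) (0 : Fin 3) (4 - k)).mul (isHomogeneous_X_pow 2 k)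
    rwa [show 4 - k + k = 4 by omega] at this
  rw [h _ hG, Finset.sum_filter]
  refine Finset.sum_congr rfl fun i _ => ?_
  simp only [map_mul, map_pow, eval_X]
  split_ifs with hi
  · rw [div_pow, show (4 : ℕ) = 4 - k + k by omega, pow_add, Nat.add_sub_cancel]
    field_simp
  · rw [not_not.1 hi, zero_pow (by omega)]
    ring

/-- At least two nodes lie on the line `X₁ = 0` away from `X₀ = 0`; if there are exactly two,
the line is binodal and they are the zeros of `nodalForm`. -/
lemma two_le_card_nodes (hΦ : IsRadical Φ (X 0 * X 1)) {a : Fin 5 → ℂ} {v : Fin 5 → Fin 3 → ℂ}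
    (h : IsDecomp Φ a v) : 2 ≤ (Finset.univ.filter fun i => v i 0 ≠ 0).card ∧
      ((Finset.univ.filter fun i => v i 0 ≠ 0).card = 2 → IsBinodal Φ 0 ∧
        ∀ i, v i 0 ≠ 0 → eval (v i) (nodalForm Φ) = 0) := by
  have hs := not_single_node hΦ
  have hm := fun k (hk : k ≤ 3) => apply_line_of_isDecomp h hk
  set A := Finset.univ.filter fun i => v i 0 ≠ 0 with hA
  have hne0 : A.card ≠ 0 := fun h0 => hs ⟨0, 0, fun k hk => by
    rw [hm k hk, Finset.card_eq_zero.1 h0]; simp⟩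
  have hne1 : A.card ≠ 1 := fun h1 => by
    obtain ⟨i, hi⟩ := Finset.card_eq_one.1 h1
    exact hs ⟨_, _, fun k hk => by rw [hm k hk, hi, Finset.sum_singleton]⟩
  refine ⟨by omega, fun h2 => ?_⟩
  obtain ⟨i, j, hij, hAij⟩ := Finset.card_eq_two.1 h2
  have hm' : ∀ k ≤ 3, Φ (X 0 ^ (4 - k) * X 2 ^ k) = a i * v i 0 ^ 4 * (v i 2 / v i 0) ^ k +
      a j * v j 0 ^ 4 * (v j 2 / v j 0) ^ k := fun k hk => by
    rw [hm k hk, hAij, Finset.sum_pair hij]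
  -- Equal slopes or a zero weight would leave a single node, which is excluded.
  refine ⟨⟨_, _, _, _, fun hss => hs ⟨a i * v i 0 ^ 4 + a j * v j 0 ^ 4, v i 2 / v i 0,
    fun k hk => ?_⟩, fun h0 => hs ⟨a j * v j 0 ^ 4, v j 2 / v j 0, fun k hk => ?_⟩,
    fun h0 => hs ⟨a i * v i 0 ^ 4, v i 2 / v i 0, fun k hk => ?_⟩, hm'⟩, fun l hl => ?_⟩
  · rw [hm' k hk, ← hss]; ring
  · rw [hm' k hk, h0]; ring
  · rw [hm' k hk, h0]; ring
  · rw [eval_nodalForm hm']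
    have hlA : l ∈ A := by simpa [hA] using hl
    rw [hAij, Finset.mem_insert, Finset.mem_singleton] at hlA
    have hz : v l 2 - v l 2 / v l 0 * v l 0 = 0 := by field_simp; ring
    rcases hlA with rfl | rfl <;> rw [hz] <;> ring

/-- If both lines are binodal, their common point is a node. -/
lemma mem_nodeSet_of_isBinodal (hΦ : IsRadical Φ (X 0 * X 1)) (h0 : IsBinodal Φ 0)
    (h1 : IsBinodal Φ 1) : ![0, 0, 1] ∈ nodeSet Φ := by
  obtain ⟨s₁, s₂, c₁, c₂, -, -, -, hs⟩ := h0
  obtain ⟨t₁, t₂, d₁, d₂, -, -, -, ht⟩ := h1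
  -- Four nodes account for all monomials except `X₂ ^ 4`; the weight of the common point corrects
  -- that last value.
  refine ⟨![c₁, c₂, d₁, d₂, Φ (X 2 ^ 4) - c₁ * s₁ ^ 4 - c₂ * s₂ ^ 4 - d₁ * t₁ ^ 4 - d₂ * t₂ ^ 4],
    ![![1, 0, s₁], ![1, 0, s₂], ![0, 1, t₁], ![0, 1, t₂], ![0, 0, 1]], fun G hG => ?_,
    fun i => ?_, 4, rfl⟩
  · let E : (Fin 3 → ℂ) → MvPolynomial (Fin 3) ℂ →ₗ[ℂ] ℂ := fun v =>
      (aeval v : MvPolynomial (Fin 3) ℂ →ₐ[ℂ] ℂ).toLinearMap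
    have := apply_eq_of_two_lines (φ := Φ) (ψ := c₁ • E ![1, 0, s₁] + c₂ • E ![1, 0, s₂] +
      d₁ • E ![0, 1, t₁] + d₂ • E ![0, 1, t₂] + (Φ (X 2 ^ 4) - c₁ * s₁ ^ 4 - c₂ * s₂ ^ 4 -
        d₁ * t₁ ^ 4 - d₂ * t₂ ^ 4) • E ![0, 0, 1]) ?_ ?_ ?_ ?_ hG
    · rw [this, Fin.sum_univ_five]
      simp [E, aeval_eq_eval]
    · intro H hH
      rw [hΦ.apply_mul isHomogeneous_two_lines hH]
      simp [E]
    · intro k hk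
      rw [hs k hk]
      have : 4 - k ≠ 0 := by omega
      simp [E, this]
    · intro k hk
      rw [ht k hk]
      have : 4 - k ≠ 0 := by omega
      simp [E, this]
    · simp [E]
  · fin_cases i <;> intro h <;>
      first
      | simpa using congrFun h 0
      | simpa using congrFun h 1
      | simpa using congrFun h 2

/-- Restriction of forms to the line `X₁ = 0`. -/
noncomputable def lineRestrict : MvPolynomial (Fin 3) ℂ →ₐ[ℂ] Polynomial ℂ :=
  aeval ![1, 0, Polynomial.X]

lemma eval_lineRestrict (t : ℂ) (G : MvPolynomial (Fin 3) ℂ) :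
    (lineRestrict G).eval t = eval ![1, 0, t] G := by
  rw [lineRestrict, eval_aeval_polynomial]
  congr 2
  ext i
  fin_cases i <;> simp

/-- If one line is binodal, almost all points of the other one are nodes. -/
theorem finite_not_mem_nodeSet_line (hΦ : IsRadical Φ (X 0 * X 1)) (h1 : IsBinodal Φ 1) :
    {t : ℂ | ![1, 0, t] ∉ nodeSet Φ}.Finite := by
  obtain ⟨t₁, t₂, d₁, d₂, -, -, -, ht⟩ := h1
  -- Among the monomials `X₀^(4-k) X₂^k`, the two fixed nodes on `X₀ = 0` contribute only to `X₂ ^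
  -- 4`, whence the correction at `k = 4`.
  let lift : Polynomial ℂ →ₗ[ℂ] ℂ := (Polynomial.basisMonomials ℂ).constr ℂ fun k =>
    Φ (X 0 ^ (4 - k) * X 2 ^ k) - if k = 4 then d₁ * t₁ ^ 4 + d₂ * t₂ ^ 4 else 0
  have hlift : ∀ k, lift (Polynomial.X ^ k) =
      Φ (X 0 ^ (4 - k) * X 2 ^ k) - if k = 4 then d₁ * t₁ ^ 4 + d₂ * t₂ ^ 4 else 0 := fun k => by
    have := (Polynomial.basisMonomials ℂ).constr_basis ℂ (fun k =>
      Φ (X 0 ^ (4 - k) * X 2 ^ k) - if k = 4 then d₁ * t₁ ^ 4 + d₂ * t₂ ^ 4 else 0) k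
    rwa [basisMonomials_eq_X_pow] at this
  have key : ∀ G : MvPolynomial (Fin 3) ℂ, G.IsHomogeneous 4 → Φ G = lift (lineRestrict G) +
      d₁ * eval ![0, 1, t₁] G + d₂ * eval ![0, 1, t₂] G := by
    intro G hG
    let E : (Fin 3 → ℂ) → MvPolynomial (Fin 3) ℂ →ₗ[ℂ] ℂ := fun v =>
      (aeval v : MvPolynomial (Fin 3) ℂ →ₐ[ℂ] ℂ).toLinearMap
    have := apply_eq_of_two_lines (φ := Φ) (ψ := lift ∘ₗ lineRestrict.toLinearMap +
      d₁ • E ![0, 1, t₁] + d₂ • E ![0, 1, t₂]) ?_ ?_ ?_ ?_ hG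
    · rw [this]
      simp [E, aeval_eq_eval]
    · intro H hH
      rw [hΦ.apply_mul isHomogeneous_two_lines hH]
      simp [E, lineRestrict]
    · intro k hk
      have h4 : 4 - k ≠ 0 := by omega
      have h4' : k ≠ 4 := by omega
      simp [E, lineRestrict, h4, hlift, h4']
    · intro k hk
      rw [ht k hk]
      have : 4 - k ≠ 0 := by omega
      simp [E, lineRestrict, this]
    · simp [E, lineRestrict, hlift]
      ring
  have hdeg : ∀ {d : ℕ} {G : MvPolynomial (Fin 3) ℂ}, G.IsHomogeneous d →
      (lineRestrict G).natDegree ≤ d := fun {d G} hG =>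
    natDegree_le_of_monomial lineRestrict.toLinearMap (fun a b c habc => by
      rcases b with - | b
      · simp [lineRestrict]; omega
      · simp [lineRestrict]) hG
  have hL := Polynomial.finite_not_node (L := lift) (m := 2) (fun p hp h => ?_)
  · refine hL.subset fun t ht => ?_
    rintro ⟨x, a, rfl, hx⟩
    refine ht ⟨![a 0, a 1, a 2, d₁, d₂], ![![1, 0, x 0], ![1, 0, x 1], ![1, 0, x 2],
      ![0, 1, t₁], ![0, 1, t₂]], fun G hG => ?_, fun i => ?_, 0, rfl⟩
    · rw [key G hG, hx _ (hdeg hG), Fin.sum_univ_three, Fin.sum_univ_five]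
      simp [eval_lineRestrict]
    · fin_cases i <;> intro h <;>
        first
        | simpa using congrFun h 0
        | simpa using congrFun h 1
  -- The lift of `p` is chosen to vanish at both fixed nodes, so that only the functional on the
  -- line `X₁ = 0` sees it.
  · set G : MvPolynomial (Fin 3) ℂ := C (p.coeff 0) * X 0 ^ 2 + C (p.coeff 1) * (X 0 * X 2) +
      C (p.coeff 2) * ((X 2 - C t₁ * X 1) * (X 2 - C t₂ * X 1)) with hGdef
    have hG : G.IsHomogeneous 2 :=
      (((isHomogeneous_X_pow 0 2).C_mul _).add
        (((isHomogeneous_X ℂ 0).mul (isHomogeneous_X ℂ 2)).C_mul _)).add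
        ((((isHomogeneous_X ℂ 2).sub (isHomogeneous_C_mul_X t₁ 1)).mul
          ((isHomogeneous_X ℂ 2).sub (isHomogeneous_C_mul_X t₂ 1))).C_mul _)
    have hres : lineRestrict G = p := by
      conv_rhs => rw [p.as_sum_range_C_mul_X_pow' (Nat.lt_succ_iff.2 hp)]
      simp [hGdef, lineRestrict, Finset.sum_range_succ]
      exact Or.inl (pow_two _).symm
    obtain ⟨k, hk⟩ := (hΦ _ hG).1 fun H hH => by
      rw [key _ (hG.mul hH), map_mul, hres, h _ (hdeg hH)]
      simp [hGdef]
    have := congrArg lineRestrict hk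
    rw [hres] at this
    rw [this]
    simp [lineRestrict]

/-! ### Exchanging the two lines and counting nodes -/

lemma linSubst_linSubst (M N : (Fin 3 → ℂ) →ₗ[ℂ] (Fin 3 → ℂ)) (G : MvPolynomial (Fin 3) ℂ) :
    linSubst M (linSubst N G) = linSubst (N ∘ₗ M) G :=
  MvPolynomial.funext fun v => by simp [eval_linSubst]

/-- The exchange of the first two coordinates. -/
noncomputable def coordSwap : (Fin 3 → ℂ) ≃ₗ[ℂ] (Fin 3 → ℂ) :=
  LinearEquiv.funCongrLeft ℂ ℂ (Equiv.swap 0 1)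

lemma coordSwap_apply (v : Fin 3 → ℂ) : coordSwap v = ![v 1, v 0, v 2] := by
  ext i
  fin_cases i
  · rfl
  · rfl
  · exact congrArg v (by decide)

lemma coordSwap_symm_apply (v : Fin 3 → ℂ) : coordSwap.symm v = ![v 1, v 0, v 2] := by
  rw [LinearEquiv.symm_apply_eq, coordSwap_apply]
  ext i
  fin_cases i <;> rfl

section TwoLines

variable {Φ : MvPolynomial (Fin 3) ℂ →ₗ[ℂ] ℂ} {a : Fin 5 → ℂ} {v : Fin 5 → Fin 3 → ℂ}

lemma isRadical_pull_coordSwap (hΦ : IsRadical Φ (X 0 * X 1)) :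
    IsRadical (pull coordSwap Φ) (X 0 * X 1) := by
  have := isRadical_pull (e := coordSwap) hΦ
  rwa [show linSubst (coordSwap : (Fin 3 → ℂ) →ₗ[ℂ] (Fin 3 → ℂ)) (X 0 * X 1) = X 0 * X 1 from
    MvPolynomial.funext fun v => by
      rw [eval_linSubst]; simp [coordSwap_apply, mul_comm]] at this

lemma pull_coordSwap_apply (j k : ℕ) :
    pull coordSwap Φ (X 0 ^ j * X 2 ^ k) = Φ (X 1 ^ j * X 2 ^ k) ∧
      pull coordSwap Φ (X 1 ^ j * X 2 ^ k) = Φ (X 0 ^ j * X 2 ^ k) := by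
  constructor <;> rw [pull_apply] <;> congr 1 <;> refine MvPolynomial.funext fun v => ?_ <;>
    rw [eval_linSubst] <;> simp [coordSwap_symm_apply]

lemma isBinodal_pull_coordSwap_zero : IsBinodal (pull coordSwap Φ) 0 ↔ IsBinodal Φ 1 := by
  simp only [IsBinodal, (pull_coordSwap_apply _ _).1]

lemma isBinodal_pull_coordSwap_one : IsBinodal (pull coordSwap Φ) 1 ↔ IsBinodal Φ 0 := by
  simp only [IsBinodal, (pull_coordSwap_apply _ _).2]

lemma IsDecomp.pull (h : IsDecomp Φ a v) (e : (Fin 3 → ℂ) ≃ₗ[ℂ] (Fin 3 → ℂ)) :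
    IsDecomp (pull e Φ) a fun i => e.symm (v i) :=
  isDecomp_pull_iff.2 (by simpa using h)

lemma two_le_card_nodes' (hΦ : IsRadical Φ (X 0 * X 1)) (h : IsDecomp Φ a v) :
    2 ≤ (Finset.univ.filter fun i => v i 1 ≠ 0).card ∧
      ((Finset.univ.filter fun i => v i 1 ≠ 0).card = 2 → IsBinodal Φ 1) := by
  obtain ⟨h1, h2⟩ := two_le_card_nodes (isRadical_pull_coordSwap hΦ) (h.pull coordSwap)
  simp only [coordSwap_symm_apply, Matrix.cons_val_zero] at h1 h2
  exact ⟨h1, fun hc => isBinodal_pull_coordSwap_zero.1 (h2 hc).1⟩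

/-- Each vector lies on one of the lines. The third class counts those over the common point,
together with any zero vectors, which a decomposition may contain. -/
lemma card_nodes_add_card_nodes (hΦ : IsRadical Φ (X 0 * X 1)) (h : IsDecomp Φ a v) :
    (Finset.univ.filter fun i => v i 0 ≠ 0).card + (Finset.univ.filter fun i => v i 1 ≠ 0).card +
      (Finset.univ.filter fun i => v i 0 = 0 ∧ v i 1 = 0).card = 5 := by
  have hz : ∀ i, v i 0 = 0 ∨ v i 1 = 0 := fun i => by
    have := (hΦ.eval_eq_zero h).2 i
    simpa using this
  rw [← Finset.card_union_of_disjoint, ← Finset.card_union_of_disjoint]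
  · refine (congrArg Finset.card (?_ : _ = Finset.univ)).trans (by simp)
    ext i
    simp
    tauto
  · rw [Finset.disjoint_left]
    intro i hi hi'
    simp at hi hi'
    tauto
  · rw [Finset.disjoint_left]
    intro i hi hi'
    simp at hi hi'
    exact (hz i).elim hi hi'

lemma isBinodal_or_isBinodal (hΦ : IsRadical Φ (X 0 * X 1)) (h : IsDecomp Φ a v) :
    IsBinodal Φ 0 ∨ IsBinodal Φ 1 := by
  have h1 := two_le_card_nodes hΦ h
  have h2 := two_le_card_nodes' hΦ h
  have h3 := card_nodes_add_card_nodes hΦ h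
  by_cases h4 : (Finset.univ.filter fun i => v i 0 ≠ 0).card = 2
  · exact Or.inl (h1.2 h4).1
  · exact Or.inr (h2.2 (by omega))

lemma isBinodal_and_isBinodal (hΦ : IsRadical Φ (X 0 * X 1)) (h : ![0, 0, 1] ∈ nodeSet Φ) :
    IsBinodal Φ 0 ∧ IsBinodal Φ 1 := by
  obtain ⟨a, v, h, -, i, hi⟩ := h
  have h1 := two_le_card_nodes hΦ h
  have h2 := two_le_card_nodes' hΦ h
  have h3 := card_nodes_add_card_nodes hΦ h
  have h4 : 0 < (Finset.univ.filter fun i => v i 0 = 0 ∧ v i 1 = 0).card :=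
    Finset.card_pos.2 ⟨i, by simp [hi]⟩
  exact ⟨(h1.2 (by omega)).1, h2.2 (by omega)⟩

/-- The line `X₀ = 0` now takes at least three of the five nodes away from the common point. Exactly
two remain for `X₁ = 0`, and none for the common point. -/
lemma eval_nodalForm_of_not_isBinodal (hΦ : IsRadical Φ (X 0 * X 1)) (hn : ¬ IsBinodal Φ 1)
    {u : Fin 3 → ℂ} (hu : u ∈ nodeSet Φ) (hu1 : u 1 = 0) : eval u (nodalForm Φ) = 0 := by
  obtain ⟨a, v, h, -, i, rfl⟩ := hu
  have h1 := two_le_card_nodes hΦ h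
  have h2 := two_le_card_nodes' hΦ h
  have h3 := card_nodes_add_card_nodes hΦ h
  have h4 : (Finset.univ.filter fun i => v i 1 ≠ 0).card ≠ 2 := fun h => hn (h2.2 h)
  refine (h1.2 (by omega)).2 i fun h0 => ?_
  have h5 : 0 < (Finset.univ.filter fun i => v i 0 = 0 ∧ v i 1 = 0).card :=
    Finset.card_pos.2 ⟨i, by simp [h0, hu1]⟩
  omega

lemma IsBinodal.eval_nodalForm_ne_zero (h : IsBinodal Φ 0) :
    eval ![0, 0, 1] (nodalForm Φ) ≠ 0 := by
  obtain ⟨s₁, s₂, c₁, c₂, hs, h1, h2, h⟩ := h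
  rw [eval_nodalForm h]
  simpa [h1, h2] using sub_ne_zero.2 hs

end TwoLines

/-! ### The Waring locus -/

section Locus

variable {f : MvPolynomial (Fin 3) ℂ}

lemma waringLocus_subset_zeroLocus {c : MvPolynomial (Fin 3) ℂ} (hf : f.IsHomogeneous 4)
    (hrank : waringRank 4 f = 5) (hc : IsRadical (contraction f) c) :
    waringLocus 4 f ⊆ zeroLocus c := by
  intro P hP
  obtain ⟨a, v, h, -, i, hi⟩ := (mem_waringLocus_iff hf hrank).1 hP
  have := (hc.eval_eq_zero h).2 i
  rwa [hi] at this

lemma subset_closure_waringLocus_inter {l : MvPolynomial (Fin 3) ℂ} (hf : f.IsHomogeneous 4)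
    (hrank : waringRank 4 f = 5) {e : (Fin 3 → ℂ) ≃ₗ[ℂ] (Fin 3 → ℂ)} (hl : l.IsHomogeneous 1)
    (hel : linSubst (e : (Fin 3 → ℂ) →ₗ[ℂ] (Fin 3 → ℂ)) l = X 1)
    (hΦ : IsRadical (pull e (contraction f)) (X 0 * X 1))
    (hb : IsBinodal (pull e (contraction f)) 1) :
    zeroLocus l ⊆ closure[zariski 2] (waringLocus 4 f ∩ zeroLocus l) := by
  have hl' : ∀ u, eval (e u) l = u 1 := fun u => by
    have := eval_linSubst (e : (Fin 3 → ℂ) →ₗ[ℂ] (Fin 3 → ℂ)) u l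
    rw [hel, eval_X] at this
    exact this.symm
  have hne : ∀ t : ℂ, e ![1, 0, t] ≠ 0 := fun t h => by
    rw [LinearEquiv.map_eq_zero_iff] at h
    simpa using congrFun h 0
  refine subset_closure_of_curve (fun t => Projectivization.mk ℂ _ (hne t)) ?_ ?_
  · refine (finite_not_mem_nodeSet_line hΦ hb).subset fun t ht hmem => ht ⟨?_, ?_⟩
    · rwa [mk_mem_waringLocus_iff hf hrank, ← mem_nodeSet_pull_iff]
    · rw [mk_mem_zeroLocus_iff hl, hl']
      simp
  · intro P hP d g hg hinf
    simp only [mk_mem_zeroLocus_iff hg] at hinf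
    have hP1 : e.symm P.rep 1 = 0 := by
      rw [← hl' (e.symm P.rep), LinearEquiv.apply_symm_apply]; exact hP
    obtain ⟨s, hs⟩ := IsAlgClosed.exists_pow_nat_eq (e.symm P.rep 0) two_pos
    obtain ⟨t, ht⟩ := IsAlgClosed.exists_pow_nat_eq (e.symm P.rep 2) two_pos
    -- The line is covered by the quadratic curve with middle vector 0, that is, by the substitution
    -- `t ↦ t²`; infinitely many parameters have infinitely many square roots.
    have h := eval_quadratic_curve_eq_zero hg (e ![1, 0, 0]) 0 (e ![0, 0, 1])
      ((hinf.preimage (f := fun t : ℂ => t ^ 2) fun x _ =>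
        IsAlgClosed.exists_pow_nat_eq x two_pos).mono fun x hx => ?_) s t
    · have hrep : s ^ 2 • e ![1, 0, 0] + (s * t) • (0 : Fin 3 → ℂ) + t ^ 2 • e ![0, 0, 1] =
          P.rep := by
        rw [smul_zero, add_zero, ← map_smul, ← map_smul, ← map_add, ← LinearEquiv.eq_symm_apply]
        ext i
        fin_cases i <;> simp [hs, ht, hP1]
      rw [hrep] at h
      exact h
    · have : e ![1, 0, 0] + x • (0 : Fin 3 → ℂ) + x ^ 2 • e ![0, 0, 1] = e ![1, 0, x ^ 2] := by
        rw [smul_zero, add_zero, ← map_smul, ← map_add]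
        congr 1
        ext i
        fin_cases i <;> simp
      rw [Set.mem_ofPred_eq, this]
      exact hx

/-- The Waring locus is dense in a line of the conic iff the other line is binodal. -/
lemma denseIn_line_iff {l : MvPolynomial (Fin 3) ℂ} (hf : f.IsHomogeneous 4)
    (hrank : waringRank 4 f = 5) {e : (Fin 3 → ℂ) ≃ₗ[ℂ] (Fin 3 → ℂ)} (hl : l.IsHomogeneous 1)
    (hel : linSubst (e : (Fin 3 → ℂ) →ₗ[ℂ] (Fin 3 → ℂ)) l = X 1)
    (hΦ : IsRadical (pull e (contraction f)) (X 0 * X 1)) :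
    DenseIn (waringLocus 4 f ∩ zeroLocus l) (zeroLocus l) ↔
      IsBinodal (pull e (contraction f)) 1 := by
  refine ⟨fun hd => ?_, fun hb => ⟨Set.inter_subset_right,
    subset_closure_waringLocus_inter hf hrank hl hel hΦ hb⟩⟩
  by_contra hn
  have hl' : ∀ u, eval (e u) l = u 1 := fun u => by
    have := eval_linSubst (e : (Fin 3 → ℂ) →ₗ[ℂ] (Fin 3 → ℂ)) u l
    rw [hel, eval_X] at this
    exact this.symm
  obtain ⟨a, v, hdec⟩ := exists_isDecomp hf hrank
  have h0 := (isBinodal_or_isBinodal hΦ (hdec.pull e)).resolve_right hn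
  let g := linSubst (e.symm : (Fin 3 → ℂ) →ₗ[ℂ] (Fin 3 → ℂ))
    (nodalForm (pull e (contraction f)))
  have hg : g.IsHomogeneous 2 := isHomogeneous_linSubst _ isHomogeneous_nodalForm
  have hsub : waringLocus 4 f ∩ zeroLocus l ⊆ zeroLocus g := by
    rintro P ⟨hPW, hPl⟩
    rw [mem_waringLocus_iff hf hrank] at hPW
    have hPe : e (e.symm P.rep) = P.rep := e.apply_symm_apply _
    change eval P.rep g = 0
    rw [eval_linSubst]
    refine eval_nodalForm_of_not_isBinodal hΦ hn (mem_nodeSet_pull_iff.2 (by simpa using hPW)) ?_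
    change e.symm P.rep 1 = 0
    rw [← hl' (e.symm P.rep), hPe]
    exact hPl
  have hcl : zeroLocus l ⊆ zeroLocus g := by
    let := zariski 2
    exact hd.2.trans (closure_minimal hsub (isClosed_zeroLocus hg))
  -- The common point of the two lines separates: it lies on `l`, but the nodal quadric does not
  -- vanish there.
  have hQ : e ![0, 0, 1] ≠ 0 := fun h => by
    rw [LinearEquiv.map_eq_zero_iff] at h
    simpa using congrFun h 2
  have hQl : Projectivization.mk ℂ _ hQ ∈ zeroLocus l := by
    rw [mk_mem_zeroLocus_iff hl, hl']
    simp
  have := (mk_mem_zeroLocus_iff hg hQ).1 (hcl hQl)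
  rw [eval_linSubst] at this
  exact h0.eval_nodalForm_ne_zero (by simpa using this)

/-- The Waring locus is dense in a smooth conic. -/
lemma zeroLocus_subset_closure_of_irreducible {c : MvPolynomial (Fin 3) ℂ}
    (hf : f.IsHomogeneous 4) (hrank : waringRank 4 f = 5) (hc2 : c.IsHomogeneous 2)
    (hc : IsRadical (contraction f) c) (hirr : Irreducible c) :
    zeroLocus c ⊆ closure[zariski 2] (waringLocus 4 f) := by
  obtain ⟨e, he⟩ := exists_frame_of_irreducible hc2 hirr
  have hΦ := isRadical_pull (e := e) hc
  rw [he] at hΦ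
  have hne : ∀ t : ℂ, e ![1, t, t ^ 2] ≠ 0 := fun t h => by
    rw [LinearEquiv.map_eq_zero_iff] at h
    simpa using congrFun h 0
  refine subset_closure_of_curve (fun t => Projectivization.mk ℂ _ (hne t)) ?_ ?_
  · refine (finite_not_mem_nodeSet_conic hΦ).subset fun t ht hmem => ht ?_
    rwa [mk_mem_waringLocus_iff hf hrank, ← mem_nodeSet_pull_iff]
  · intro P hP d g hg hinf
    simp only [mk_mem_zeroLocus_iff hg] at hinf
    have hPc : e.symm P.rep 0 * e.symm P.rep 2 = e.symm P.rep 1 ^ 2 := by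
      have h1 := eval_linSubst (e : (Fin 3 → ℂ) →ₗ[ℂ] (Fin 3 → ℂ)) (e.symm P.rep) c
      have h2 : eval P.rep c = 0 := hP
      rw [he, LinearEquiv.coe_coe, LinearEquiv.apply_symm_apply, h2] at h1
      simpa [sub_eq_zero] using h1
    obtain ⟨s, hs⟩ := IsAlgClosed.exists_pow_nat_eq (e.symm P.rep 0) two_pos
    -- The conic equation determines `s * t` up to sign, and the sign of the root `t` can be
    -- adjusted.
    obtain ⟨t, ht, hst⟩ : ∃ t : ℂ, t ^ 2 = e.symm P.rep 2 ∧ s * t = e.symm P.rep 1 := by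
      obtain ⟨t, ht⟩ := IsAlgClosed.exists_pow_nat_eq (e.symm P.rep 2) two_pos
      have : (s * t) ^ 2 = e.symm P.rep 1 ^ 2 := by rw [mul_pow, hs, ht, hPc]
      rcases sq_eq_sq_iff_eq_or_eq_neg.1 this with h | h
      · exact ⟨t, ht, h⟩
      · exact ⟨-t, by rw [neg_sq, ht], by rw [mul_neg, h, neg_neg]⟩
    have h := eval_quadratic_curve_eq_zero hg (e ![1, 0, 0]) (e ![0, 1, 0]) (e ![0, 0, 1])
      (hinf.mono fun x hx => ?_) s t
    · have hrep : s ^ 2 • e ![1, 0, 0] + (s * t) • e ![0, 1, 0] + t ^ 2 • e ![0, 0, 1] =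
          P.rep := by
        rw [← map_smul, ← map_smul, ← map_smul, ← map_add, ← map_add,
          ← LinearEquiv.eq_symm_apply]
        ext i
        fin_cases i <;> simp [hs, ht, hst]
      rw [hrep] at h
      exact h
    · have : e ![1, 0, 0] + x • e ![0, 1, 0] + x ^ 2 • e ![0, 0, 1] = e ![1, x, x ^ 2] := by
        rw [← map_smul, ← map_smul, ← map_add, ← map_add]
        congr 1
        ext i
        fin_cases i <;> simp
      rw [Set.mem_ofPred_eq, this]
      exact hx

end Locus

end WaringLoci

/-! ### The main theorem -/

open WaringLoci

theorem mainTheorem11 (f c : MvPolynomial (Fin 3) ℂ) (hf : f.IsHomogeneous 4)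
    (hrank : WaringLoci.waringRank 4 f = 5)
    (hc : WaringLoci.apolarPart f 2 = Submodule.span ℂ {c}) :
    (Irreducible c →
      WaringLoci.DenseIn (WaringLoci.waringLocus 4 f) (WaringLoci.zeroLocus c)) ∧
    (¬ Irreducible c →
      (∃ l₁ l₂ : MvPolynomial (Fin 3) ℂ,
        l₁.IsHomogeneous 1 ∧ l₂.IsHomogeneous 1 ∧ c = l₁ * l₂) ∧
      ∀ l₁ l₂ : MvPolynomial (Fin 3) ℂ,
        l₁.IsHomogeneous 1 → l₂.IsHomogeneous 1 → c = l₁ * l₂ →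
        ∃ Q : ℙ ℂ (Fin 3 → ℂ),
          WaringLoci.zeroLocus l₁ ∩ WaringLoci.zeroLocus l₂ = {Q} ∧
          (Q ∉ WaringLoci.forbiddenLocus 4 f →
            WaringLoci.DenseIn (WaringLoci.waringLocus 4 f) (WaringLoci.zeroLocus c)) ∧
          (Q ∈ WaringLoci.forbiddenLocus 4 f →
            Xor
              (WaringLoci.DenseIn (WaringLoci.waringLocus 4 f ∩ WaringLoci.zeroLocus l₁)
                (WaringLoci.zeroLocus l₁))
              (WaringLoci.DenseIn (WaringLoci.waringLocus 4 f ∩ WaringLoci.zeroLocus l₂)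
                (WaringLoci.zeroLocus l₂)))) := by
  have hrad := isRadical_contraction hf hc
  have hc2 : c.IsHomogeneous 2 := by
    have : c ∈ apolarPart f 2 := hc ▸ Submodule.mem_span_singleton_self c
    exact (mem_homogeneousSubmodule _ _).1 this.1
  obtain ⟨a, v, hdec⟩ := exists_isDecomp hf hrank
  have hsub := waringLocus_subset_zeroLocus hf hrank hrad
  refine ⟨fun hirr => ⟨hsub, zeroLocus_subset_closure_of_irreducible hf hrank hc2 hrad hirr⟩,
    fun hred => ⟨exists_linear_factors hc2 (hrad.eval_eq_zero hdec).1 hred, ?_⟩⟩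
  rintro l₁ l₂ hl₁ hl₂ rfl
  obtain ⟨e, he₁, he₂⟩ := exists_frame_of_mul hl₁ hl₂ hrad hdec
  have hΦ := isRadical_pull (e := e) hrad
  rw [map_mul, he₁, he₂] at hΦ
  have hev : ∀ u, eval (e u) l₁ = u 0 ∧ eval (e u) l₂ = u 1 := fun u => by
    have h₁ := eval_linSubst (e : (Fin 3 → ℂ) →ₗ[ℂ] (Fin 3 → ℂ)) u l₁
    have h₂ := eval_linSubst (e : (Fin 3 → ℂ) →ₗ[ℂ] (Fin 3 → ℂ)) u l₂
    rw [he₁, eval_X] at h₁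
    rw [he₂, eval_X] at h₂
    exact ⟨h₁.symm, h₂.symm⟩
  have hd₂ := denseIn_line_iff hf hrank hl₂ he₂ hΦ
  -- The criterion is formulated for the line `X₁ = 0`; exchanging the coordinates transfers it to
  -- the other line.
  have hd₁ : DenseIn (waringLocus 4 f ∩ zeroLocus l₁) (zeroLocus l₁) ↔
      IsBinodal (pull e (contraction f)) 0 := by
    have hpull : pull (coordSwap.trans e) (contraction f) =
        pull coordSwap (pull e (contraction f)) := by
      refine LinearMap.ext fun G => ?_
      rw [pull_apply, pull_apply, pull_apply, linSubst_linSubst]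
      rfl
    rw [← isBinodal_pull_coordSwap_one, ← hpull]
    refine denseIn_line_iff hf hrank hl₁ ?_ (by rw [hpull]; exact isRadical_pull_coordSwap hΦ)
    refine MvPolynomial.funext fun u => ?_
    rw [eval_linSubst, LinearEquiv.coe_coe, LinearEquiv.trans_apply, (hev _).1, coordSwap_apply,
      eval_X]
    rfl
  have hQ0 : e ![0, 0, 1] ≠ 0 := fun h => by
    rw [LinearEquiv.map_eq_zero_iff] at h
    simpa using congrFun h 2
  have hQW : Projectivization.mk ℂ _ hQ0 ∈ waringLocus 4 f ↔
      IsBinodal (pull e (contraction f)) 0 ∧ IsBinodal (pull e (contraction f)) 1 := by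
    rw [mk_mem_waringLocus_iff hf hrank, ← mem_nodeSet_pull_iff]
    exact ⟨isBinodal_and_isBinodal hΦ, fun h => mem_nodeSet_of_isBinodal hΦ h.1 h.2⟩
  refine ⟨Projectivization.mk ℂ _ hQ0, ?_, fun hQ => ⟨hsub, ?_⟩, fun hQ => ?_⟩
  · ext P
    rw [Set.mem_inter_iff, Set.mem_singleton_iff]
    constructor
    · rintro ⟨h₁, h₂⟩
      have h₁' : e.symm P.rep 0 = 0 := by
        rw [← (hev (e.symm P.rep)).1, LinearEquiv.apply_symm_apply]; exact h₁
      have h₂' : e.symm P.rep 1 = 0 := by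
        rw [← (hev (e.symm P.rep)).2, LinearEquiv.apply_symm_apply]; exact h₂
      rw [← P.mk_rep, Projectivization.mk_eq_mk_iff']
      refine ⟨e.symm P.rep 2, ?_⟩
      rw [← map_smul, ← LinearEquiv.eq_symm_apply]
      ext i
      fin_cases i <;> simp [h₁', h₂']
    · rintro rfl
      rw [mk_mem_zeroLocus_iff hl₁, mk_mem_zeroLocus_iff hl₂, (hev _).1, (hev _).2]
      simp
  · have hb := hQW.1 (not_not.1 hQ)
    have h₁ := (hd₁.2 hb.1).2
    have h₂ := (hd₂.2 hb.2).2
    let := zariski 2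
    intro P hP
    have hP' : eval P.rep l₁ * eval P.rep l₂ = 0 := by rw [← map_mul]; exact hP
    rcases mul_eq_zero.1 hP' with h | h
    · exact closure_mono Set.inter_subset_left (h₁ h)
    · exact closure_mono Set.inter_subset_left (h₂ h)
  -- A forbidden `Q` excludes that both lines are binodal, while at least one always is.
  · have hnb : ¬ (_ ∧ _) := fun h => hQ (hQW.2 h)
    have hor := isBinodal_or_isBinodal hΦ (hdec.pull e)
    rw [hd₁, hd₂]
    rcases hor with h | h
    · exact Or.inl ⟨h, fun h' => hnb ⟨h, h'⟩⟩
    · exact Or.inr ⟨h, fun h' => hnb ⟨h', h⟩⟩
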